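/- Let $J$ be a simple Euclidean Jordan algebra, that is, a finite-dimensional unital real Jordan algebra without ideals other than $0$ and $J\neq 0$, with an inner product $(\cdot,\cdot)$ such that $(xy,z)=(y,xz)$. Let $e$ be its unit, $r$ its rank, $\det$ its determinant (the constant coefficient of the generic minimal polynomial, up to the sign $(-1)^r$), $\Omega$ its symmetric cone (the set of squares of invertible elements), $\mathbb J=J\otimes_{\mathbb R}\mathbb C$ its complexification and $T_\Omega=J+i\Omega\subset\mathbb J$. Let $(E,\Phi)$ be a representation of $J$, i.e. $E$ is a Euclidean space of finite dimension $N$ with inner product $\langle\cdot,\cdot\rangle$, and $\Phi$ is a linear map from $J$ to the symmetric endomorphisms of $E$ with $\Phi(xy)=\frac12(\Phi(x)\Phi(y)+\Phi(y)\Phi(x))$ and $\Phi(e)=\mathrm{Id}_E$. Let $Q:E\to J$ be the quadratic map defined by $(Q(\xi),x)=\langle\Phi(x)\xi,\xi\rangle$ for all $x\in J$, and assume that the representation is regular, i.e. that $Q(\xi)=e$ for some $\xi\in E$. Extend the inner product of $J$ to a $\mathbb C$-bilinear form on $\mathbb J$, $\det$ to a holomorphic polynomial on $\mathbb J$, and $\Phi$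 to a $\mathbb C$-linear map from $\mathbb J$ to the endomorphisms of $\mathbb E=E\otimes_{\mathbb R}\mathbb C$. Let $p$ be a (complex-valued) pluriharmonic polynomial on $E$, i.e. $\Delta_E(p\circ\Phi(x))=0$ for all $x\in J$, where $\Delta_E$ is the Laplacian of $E$, and extend $p$ holomorphically to $\mathbb E$. Then every $z\in T_\Omega$ is invertible in $\mathbb J$, and for all $z\in T_\Omega$ and $\eta\in E$ the following integral converges absolutely and $$\int_E e^{i\langle\xi,\eta\rangle}\,e^{\frac i2(z,Q(\xi))}\,p(\xi)\,d\xi=(2\pi)^{\frac N2}\,\Big(\det\frac zi\Big)^{-\frac N{2r}}\,e^{\frac i2(-z^{-1},Q(\eta))}\,p\big(\Phi(-z^{-1})\eta\big),$$ where $d\xi$ is the Lebesgue measure of the Euclidean space $E$ and $\big(\det\frac zi\big)^{-\frac N{2r}}$ is the continuous determination on $T_\Omega$ (which exists) that equals $(\det y)^{-\frac N{2r}}>0$ at $z=iy$, $y\in\Omega$. -/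

import Mathlib

open scoped TensorProduct
open MeasureTheory

noncomputable section

namespace JordanHecke

/-! ### Powers, inverses, rank and minimal polynomials in a Jordan algebra -/

/-- The powers `x ^ 0 = e`, `x ^ (n + 1) = x (x ^ n)` in a (non-associative) unital algebra. -/
def jpow {A : Type*} [Mul A] [One A] (x : A) : ℕ → A
  | 0 => 1
  | n + 1 => x * jpow x n

/-- The space `F[x]` of polynomials in `x` with coefficients in `F`. -/
def polySpan (F : Type*) {A : Type*} [Field F] [NonAssocRing A] [Module F A] (x : A) :
    Submodule F A :=
  Submodule.span F (Set.range (jpow x))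

/-- `w` is the inverse of `x` in the Jordan algebra `A` over `F`: it is a polynomial in `x`
and `x w = e`. -/
def IsJInverse (F : Type*) {A : Type*} [Field F] [NonAssocRing A] [Module F A] (x w : A) : Prop :=
  w ∈ polySpan F x ∧ x * w = 1

/-- The inverse of `x` (with value `0` if `x` is not invertible). -/
def jinv (F : Type*) {A : Type*} [Field F] [NonAssocRing A] [Module F A] (x : A) : A :=
  open Classical in if h : ∃ w, IsJInverse F x w then h.choose else 0

section Real

variable (J : Type*) [NonAssocCommRing J] [Module ℝ J]

variable {J} in
/-- The degree of `x`: the dimension of `ℝ[x]`, which is the degree of the minimal polynomial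
of `x`. -/
def jdegree (x : J) : ℕ := Module.finrank ℝ (polySpan ℝ x)

/-- The rank of `J`: the largest degree of an element. -/
def jrank : ℕ := ⨆ x : J, jdegree x

variable {J} in
/-- `f` is the minimal polynomial of `x`: the monic polynomial of degree `dim ℝ[x]` such that
`f(x) = 0`. -/
def IsJMinpoly (x : J) (f : Polynomial ℝ) : Prop :=
  f.Monic ∧ f.natDegree = jdegree x ∧ f.sum (fun n a => a • jpow x n) = 0

/-- The symmetric cone `Ω`: the set of squares of invertible elements. -/
def cone : Set J := {y | ∃ x w : J, IsJInverse ℝ x w ∧ y = x * x}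

/-- The tube `T_Ω = J + i Ω` in the complexification `ℂ ⊗ J`. -/
def tube : Set (ℂ ⊗[ℝ] J) :=
  {z | ∃ x : J, ∃ y ∈ cone J, z = (1 : ℂ) ⊗ₜ[ℝ] x + Complex.I ⊗ₜ[ℝ] y}

end Real

/-! ### Polynomials on a real vector space and on its complexification -/

/-- The value at `z`, a point of the complexification `ℂ ⊗ V`, of the polynomial `p` in the
coordinates of the real basis `b` of `V`. -/
def polyEval {ι V : Type*} [AddCommGroup V] [Module ℝ V] (b : Module.Basis ι ℝ V)
    (p : MvPolynomial ι ℂ) (z : ℂ ⊗[ℝ] V) : ℂ :=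
  MvPolynomial.eval (fun i => (b.baseChange ℂ).repr z i) p

/-- The value of a complex-valued polynomial at a point of the real space `V`. -/
def polyEvalReal {ι V : Type*} [AddCommGroup V] [Module ℝ V] (b : Module.Basis ι ℝ V)
    (p : MvPolynomial ι ℂ) (v : V) : ℂ :=
  MvPolynomial.eval (fun i => ((b.repr v i : ℝ) : ℂ)) p

/-- The evaluation on `ℂ ⊗ V` extends the evaluation on `V`. -/
theorem polyEval_one_tmul {ι V : Type*} [AddCommGroup V] [Module ℝ V] (b : Module.Basis ι ℝ V)
    (p : MvPolynomial ι ℂ) (v : V) :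
    polyEval b p ((1 : ℂ) ⊗ₜ[ℝ] v) = polyEvalReal b p v := by
  simp [polyEval, polyEvalReal, Module.Basis.baseChange_repr_tmul]

/-! ### The determinant -/

section Det

variable (J : Type*) [NonAssocCommRing J] [Module ℝ J] [Module.Finite ℝ J]

/-- `d` is the determinant polynomial of `J`, in the coordinates of a basis: on the elements of
maximal degree `r = rank J`, `d` is `(-1) ^ r` times the constant coefficient of the minimal
polynomial. As these elements are dense this determines `d`. -/
def IsDetPoly (d : MvPolynomial (Fin (Module.finrank ℝ J)) ℝ) : Prop :=
  ∀ x : J, jdegree x = jrank J → ∀ f : Polynomial ℝ, IsJMinpoly x f →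
    MvPolynomial.eval (fun i => (Module.finBasis ℝ J).repr x i) d = (-1) ^ jrank J * f.coeff 0

/-- The determinant polynomial of `J`. -/
def detPoly : MvPolynomial (Fin (Module.finrank ℝ J)) ℝ :=
  open Classical in if h : ∃ d, IsDetPoly J d then h.choose else 0

variable {J}

/-- The determinant of an element of `J`. -/
def jdet (x : J) : ℝ :=
  MvPolynomial.eval (fun i => (Module.finBasis ℝ J).repr x i) (detPoly J)

/-- The determinant on the complexification `ℂ ⊗ J`: the holomorphic polynomial extending that
of `J`. -/
def cdet (z : ℂ ⊗[ℝ] J) : ℂ :=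
  polyEval (Module.finBasis ℝ J) (MvPolynomial.map (algebraMap ℝ ℂ) (detPoly J)) z

variable (J)

/-- `D` is, on the tube `T_Ω`, the continuous determination of the power `(det (z / i)) ^ s`
which takes the positive value `(det y) ^ s` at `z = i y`, `y ∈ Ω`. Continuity is expressed in
complex linear coordinates of `ℂ ⊗ J`. -/
structure IsDetPowBranch (s : ℝ) (D : ℂ ⊗[ℝ] J → ℂ) : Prop where
  continuousOn :
    ContinuousOn
      (fun u : Fin (Module.finrank ℝ J) → ℂ =>
        D (((Module.finBasis ℝ J).baseChange ℂ).equivFun.symm u))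
      {u | ((Module.finBasis ℝ J).baseChange ℂ).equivFun.symm u ∈ tube J}
  isPower : ∀ z ∈ tube J, ∃ l : ℂ,
    Complex.exp l = cdet ((Complex.I)⁻¹ • z) ∧ D z = Complex.exp ((s : ℂ) * l)
  normalized : ∀ y ∈ cone J, D (Complex.I ⊗ₜ[ℝ] y) = ((jdet y ^ s : ℝ) : ℂ)

end Det

/-! ### Euclidean Jordan algebras and their representations -/

section Euclidean

variable {J : Type*} [NonAssocCommRing J] [Module ℝ J]

/-- `B` is a Euclidean structure on the Jordan algebra `J`: a symmetric, positive definite and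
associative bilinear form. -/
structure IsEuclideanForm (B : LinearMap.BilinForm ℝ J) : Prop where
  symm : ∀ x y, B x y = B y x
  pos : ∀ x, x ≠ 0 → 0 < B x x
  assoc : ∀ x y z, B (x * y) z = B y (x * z)

theorem IsEuclideanForm.nondegenerate {B : LinearMap.BilinForm ℝ J} (hB : IsEuclideanForm B) :
    B.Nondegenerate := by
  constructor
  · intro x hx
    by_contra h
    exact (hB.pos x h).ne' (hx x)
  · intro x hx
    by_contra h
    exact (hB.pos x h).ne' (hx x)

variable {E : Type*} [NormedAddCommGroup E] [InnerProductSpace ℝ E]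

/-- `Φ` is a representation of the Jordan algebra `J` on the Euclidean space `E`: a unital Jordan
algebra morphism from `J` into the symmetric endomorphisms of `E`. -/
structure IsRepresentation (Φ : J →ₗ[ℝ] Module.End ℝ E) : Prop where
  map_mul : ∀ x y, Φ (x * y) = (1 / 2 : ℝ) • (Φ x * Φ y + Φ y * Φ x)
  map_one : Φ 1 = 1
  symm : ∀ x ξ η, inner ℝ (Φ x ξ) η = inner ℝ ξ (Φ x η)

/-- The polynomial `p` on `E` is pluriharmonic: `Δ (p ∘ Φ(x)) = 0` for all `x ∈ J`. -/
def IsPluriharmonic [FiniteDimensional ℝ E] (Φ : J →ₗ[ℝ] Module.End ℝ E) {ι : Type*}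
    (b : Module.Basis ι ℝ E) (p : MvPolynomial ι ℂ) : Prop :=
  ∀ x : J, ∀ ξ : E, Laplacian.laplacian (fun ζ : E => polyEvalReal b p (Φ x ζ)) ξ = 0

/-- The `ℂ`-linear extension `ℂ ⊗ J → End (ℂ ⊗ E)` of `Φ`. -/
def complexRep (Φ : J →ₗ[ℝ] Module.End ℝ E) :
    ℂ ⊗[ℝ] J →ₗ[ℂ] (ℂ ⊗[ℝ] E →ₗ[ℂ] ℂ ⊗[ℝ] E) :=
  LinearMap.liftBaseChange ℂ (LinearMap.baseChangeHom ℝ ℂ E E ∘ₗ Φ)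

variable [Module.Finite ℝ J]

/-- The bilinear map `H : E × E → J` with `(H(ξ, η), x) = ⟨Φ(x) ξ, η⟩` for all `x`. -/
def hmap {B : LinearMap.BilinForm ℝ J} (hB : IsEuclideanForm B)
    (Φ : J →ₗ[ℝ] Module.End ℝ E) (ξ η : E) : J :=
  (B.toDual hB.nondegenerate).symm (((innerₗ E).flip η) ∘ₗ (LinearMap.applyₗ ξ) ∘ₗ Φ)

theorem hmap_spec {B : LinearMap.BilinForm ℝ J} (hB : IsEuclideanForm B)
    (Φ : J →ₗ[ℝ] Module.End ℝ E) (ξ η : E) (x : J) :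
    B (hmap hB Φ ξ η) x = inner ℝ (Φ x ξ) η := by
  simp [hmap, real_inner_comm]

/-- The quadratic map `Q(ξ) = H(ξ, ξ)`. -/
def qmap {B : LinearMap.BilinForm ℝ J} (hB : IsEuclideanForm B)
    (Φ : J →ₗ[ℝ] Module.End ℝ E) (ξ : E) : J := hmap hB Φ ξ ξ

/-- The representation is regular: `Q(ξ) = e` for some `ξ`. -/
def IsRegularRep {B : LinearMap.BilinForm ℝ J} (hB : IsEuclideanForm B)
    (Φ : J →ₗ[ℝ] Module.End ℝ E) : Prop := ∃ ξ : E, qmap hB Φ ξ = 1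

end Euclidean

end JordanHecke

end

/-! For z = x + iy the form (z, Q(ξ)) is ⟨Φ(x)ξ,ξ⟩ + i⟨Φ(y)ξ,ξ⟩, and Φ(y) is positive definite, so
the integral is a polynomial moment of a complex Gaussian on E. Write -z⁻¹ = x' + iy'.

The polynomial factor. Integration by parts shows that the functional I(q) = ∫ q · Gaussian
satisfies I((X_i - m_i) q) = ∑_j g_ij I(∂_j q), where m = Φ(-z⁻¹)η and g is the inverse of Φ(y) -
iΦ(x), that is Φ(y') - iΦ(x'). By Euler's identity in each degree, after translation by m, I(q) =
I(1) q(m) whenever ∑ g_ij ∂_i ∂_j q = 0 (`functional_eq_eval`). Pluriharmonicity gives this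
condition: Δ(p ∘ Φ(x)) is the operator with symbol Φ(x)² = Φ(x²) applied to p, then composed with
Φ(x). So p is killed by the operators of all elements of Ω, hence, by linearity, by those of all of
J (`IsPluriharmonic.quadOp_eq_zero`).

The Gaussian factor. With Φ(y) = W² and V = W⁻¹, an orthonormal basis diagonalizing VΦ(x)V reduces
I(1) to one-dimensional integrals (`integral_gaussExp_eq`). This yields the exponential in η and, at
η = 0, the square of the constant: (2π)^N / det(Φ(y) - iΦ(x)).

The determinant. One needs det Φ(x) = (det x)^(N/r), an identity of polynomials that therefore also
holds on the complexification. It says that all eigenvalues of Φ(x), for x of maximal degree, have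
the same multiplicity. The spectral idempotents of such an x are primitive, two of them linked by a
nonzero Peirce component have equal traces, and simplicity links them all. That det is a polynomial
at all follows from Cramer's rule and integral closedness (`IsRepresentation.exists_isDetPoly`).

The branch. The normalized Gaussian integral is continuous on the convex set T_Ω, its square is the
right power of det(z/i), and it is positive on iΩ. Hence it is a determination of the power, and
connectedness makes every determination equal to it (`IsDetPowBranch.eqOn_gaussBranch`). -/

open scoped TensorProduct
open MeasureTheory

noncomputable section

namespace JordanHecke

/-! ### Jordan morphisms into associative algebras and polynomials in an element -/

section JordanHom

variable {F A S : Type*} [Field F] [NonAssocRing A] [Module F A] [Ring S] [Algebra F S]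

/-- A unital Jordan morphism into an associative algebra. -/
structure IsJordanHom (Ψ : A →ₗ[F] S) : Prop where
  map_mul : ∀ x y, Ψ (x * y) = (1 / 2 : F) • (Ψ x * Ψ y + Ψ y * Ψ x)
  map_one : Ψ 1 = 1

/-- The linear map `f ↦ f(x)` into a power associative algebra. -/
def jaeval (F : Type*) {A : Type*} [Field F] [NonAssocRing A] [Module F A] (x : A) :
    Polynomial F →ₗ[F] A :=
  Polynomial.lsum fun n => LinearMap.toSpanSingleton F A (jpow x n)

theorem jaeval_apply (x : A) (f : Polynomial F) :
    jaeval F x f = f.sum fun n a => a • jpow x n := by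
  simp [jaeval]

theorem jaeval_monomial (x : A) (n : ℕ) (a : F) :
    jaeval F x (Polynomial.monomial n a) = a • jpow x n := by
  rw [jaeval_apply, Polynomial.sum_monomial_index]; simp

theorem range_jaeval (x : A) : LinearMap.range (jaeval F x) = polySpan F x := by
  apply le_antisymm
  · rintro _ ⟨f, rfl⟩
    rw [jaeval_apply, Polynomial.sum_def]
    exact Submodule.sum_mem _ fun n _ =>
      Submodule.smul_mem _ _ (Submodule.subset_span ⟨n, rfl⟩)
  · refine Submodule.span_le.2 ?_
    rintro _ ⟨n, rfl⟩
    exact ⟨Polynomial.monomial n 1, by simp [jaeval_monomial]⟩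

variable {Ψ : A →ₗ[F] S}

theorem IsJordanHom.map_mul_of_commute [CharZero F] (hΨ : IsJordanHom Ψ) {x y : A}
    (h : Commute (Ψ x) (Ψ y)) : Ψ (x * y) = Ψ x * Ψ y := by
  rw [hΨ.map_mul, ← h.eq, ← two_smul F, smul_smul]
  norm_num

theorem IsJordanHom.map_jpow [CharZero F] (hΨ : IsJordanHom Ψ) (x : A) (n : ℕ) :
    Ψ (jpow x n) = Ψ x ^ n := by
  induction n with
  | zero => simp [jpow, hΨ.map_one]
  | succ n ih =>
    rw [jpow, hΨ.map_mul_of_commute, ih, pow_succ']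
    rw [ih]
    exact Commute.self_pow _ _

theorem IsJordanHom.map_jaeval [CharZero F] (hΨ : IsJordanHom Ψ) (x : A) (f : Polynomial F) :
    Ψ (jaeval F x f) = Polynomial.aeval (Ψ x) f := by
  rw [jaeval_apply, Polynomial.sum_def, map_sum, Polynomial.aeval_def, Polynomial.eval₂_def,
    Polynomial.sum_def]
  refine Finset.sum_congr rfl fun n _ => ?_
  rw [map_smul, hΨ.map_jpow, Algebra.smul_def]

theorem commute_aeval_self (s : S) (f : Polynomial F) : Commute s (Polynomial.aeval s f) := by
  simpa using (Commute.all Polynomial.X f).map (Polynomial.aeval s)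

theorem IsJordanHom.commute_of_mem_polySpan [CharZero F] (hΨ : IsJordanHom Ψ) {x w : A}
    (h : w ∈ polySpan F x) : Commute (Ψ x) (Ψ w) := by
  rw [← range_jaeval] at h
  obtain ⟨f, rfl⟩ := h
  rw [hΨ.map_jaeval]
  exact commute_aeval_self _ f

theorem IsJInverse.map_mul_eq_one [CharZero F] (hΨ : IsJordanHom Ψ) {x w : A}
    (h : IsJInverse F x w) : Ψ x * Ψ w = 1 := by
  rw [← hΨ.map_mul_of_commute (hΨ.commute_of_mem_polySpan h.1), h.2, hΨ.map_one]

theorem IsJInverse.map_mul_eq_one' [CharZero F] (hΨ : IsJordanHom Ψ) {x w : A}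
    (h : IsJInverse F x w) : Ψ w * Ψ x = 1 := by
  rw [← hΨ.commute_of_mem_polySpan h.1, h.map_mul_eq_one hΨ]

/-- Cayley–Hamilton writes a nonzero scalar as -Ψ(x) times a polynomial in Ψ(x). The same polynomial
evaluated at x, suitably scaled, is the inverse, and injectivity brings the identity back to A. -/
theorem IsJordanHom.exists_isJInverse [CharZero F] {V : Type*} [AddCommGroup V] [Module F V]
    [FiniteDimensional F V] {Ψ : A →ₗ[F] Module.End F V} (hΨ : IsJordanHom Ψ)
    (hinj : Function.Injective Ψ) {x : A} (hx : LinearMap.det (Ψ x) ≠ 0) :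
    ∃ w, IsJInverse F x w := by
  have h0 : (Ψ x).charpoly.coeff 0 ≠ 0 := by
    intro h
    apply hx
    rw [LinearMap.det_eq_sign_charpoly_coeff, h, mul_zero]
  have hC : Polynomial.aeval (Ψ x) (Ψ x).charpoly = 0 := (Ψ x).aeval_self_charpoly
  rw [← Polynomial.X_mul_divX_add (Ψ x).charpoly] at hC
  simp only [map_add, _root_.map_mul, Polynomial.aeval_X, Polynomial.aeval_C] at hC
  refine ⟨jaeval F x (-((Ψ x).charpoly.coeff 0)⁻¹ • (Ψ x).charpoly.divX), ?_, ?_⟩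
  · rw [← range_jaeval]; exact ⟨_, rfl⟩
  · apply hinj
    rw [hΨ.map_mul_of_commute, hΨ.map_one, hΨ.map_jaeval]
    · rw [map_smul, mul_smul_comm, eq_neg_of_add_eq_zero_left hC, Algebra.algebraMap_eq_smul_one]
      rw [smul_neg, neg_smul, neg_neg, smul_smul, inv_mul_cancel₀ h0, one_smul]
    · rw [hΨ.map_jaeval]
      exact commute_aeval_self _ _

theorem jinv_spec {x : A} (h : ∃ w, IsJInverse F x w) : IsJInverse F x (jinv F x) := by
  classical
  rw [jinv, dif_pos h]
  exact h.choose_spec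

end JordanHom

/-! ### Degree and minimal polynomial in terms of the eigenvalues of Φ(x). -/

section Spectral

variable {J : Type*} [NonAssocCommRing J] [Module ℝ J]
  {E : Type*} [NormedAddCommGroup E] [InnerProductSpace ℝ E]
  {Φ : J →ₗ[ℝ] Module.End ℝ E}

theorem IsRepresentation.isJordanHom (hΦ : IsRepresentation Φ) : IsJordanHom Φ :=
  ⟨hΦ.map_mul, hΦ.map_one⟩

theorem IsRepresentation.map_sq (hΦ : IsRepresentation Φ) (x : J) :
    Φ (x * x) = Φ x * Φ x :=
  hΦ.isJordanHom.map_mul_of_commute (Commute.refl _)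

/-- If Φ(x) = 0 then (x, x) = (e, x²) = (Q(ξ), x²) = ⟨Φ(x)²ξ, ξ⟩ = 0. -/
theorem IsRegularRep.injective [Module.Finite ℝ J] {B : LinearMap.BilinForm ℝ J}
    {hB : IsEuclideanForm B} (hΦ : IsRepresentation Φ) (h : IsRegularRep hB Φ) :
    Function.Injective Φ := by
  rw [injective_iff_map_eq_zero]
  intro x hx
  obtain ⟨ξ, hξ⟩ := h
  by_contra hne
  have h1 := hB.pos x hne
  have h2 := hB.assoc x 1 x
  rw [mul_one, ← hξ, qmap, hmap_spec, hΦ.map_sq, hx] at h2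
  simp [h2] at h1

theorem IsRegularRep.nontrivial [Module.Finite ℝ J] [Nontrivial J] {B : LinearMap.BilinForm ℝ J}
    {hB : IsEuclideanForm B} (h : IsRegularRep hB Φ) : Nontrivial E := by
  by_contra hE
  rw [not_nontrivial_iff_subsingleton] at hE
  obtain ⟨ξ, hξ⟩ := h
  have h1 := hB.pos 1 one_ne_zero
  rw [← hξ, qmap, hmap_spec, Subsingleton.elim ξ 0] at h1
  simp at h1

theorem IsRepresentation.exists_eigenbasis [FiniteDimensional ℝ E] (hΦ : IsRepresentation Φ)
    (x : J) : ∃ (e : OrthonormalBasis (Fin (Module.finrank ℝ E)) ℝ E)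
      (l : Fin (Module.finrank ℝ E) → ℝ), ∀ i, Φ x (e i) = l i • e i := by
  have hs : (Φ x).IsSymmetric := hΦ.symm x
  exact ⟨hs.eigenvectorBasis rfl, hs.eigenvalues rfl, fun i => hs.apply_eigenvectorBasis rfl i⟩

section Diag

variable {V ι : Type*} [AddCommGroup V] [Module ℝ V] {T : Module.End ℝ V}
  {e : Module.Basis ι ℝ V} {l : ι → ℝ}

theorem aeval_apply_of_eigen {v : V} {a : ℝ} (h : T v = a • v) (f : Polynomial ℝ) :
    Polynomial.aeval T f v = f.eval a • v := by
  induction f using Polynomial.induction_on' with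
  | add p q hp hq => simp [hp, hq, add_smul]
  | monomial n c =>
    have : ∀ n : ℕ, (T ^ n) v = a ^ n • v := by
      intro n
      induction n with
      | zero => simp
      | succ n ih => rw [pow_succ', Module.End.mul_apply, ih, map_smul, h, smul_smul, pow_succ]
    simp [Polynomial.aeval_monomial, this, smul_smul, mul_comm]

theorem aeval_eq_zero_iff_of_diag (h : ∀ i, T (e i) = l i • e i) (f : Polynomial ℝ) :
    Polynomial.aeval T f = 0 ↔ ∀ i, f.eval (l i) = 0 := by
  constructor
  · intro hf i
    have := aeval_apply_of_eigen (h i) f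
    rw [hf, LinearMap.zero_apply, eq_comm, smul_eq_zero] at this
    exact this.resolve_right (e.ne_zero i)
  · intro hf
    refine e.ext fun i => ?_
    rw [aeval_apply_of_eigen (h i), hf, zero_smul, LinearMap.zero_apply]

end Diag

section Degree

open Polynomial

variable {ι : Type*} {x : J} {e : Module.Basis ι ℝ E} {l : ι → ℝ}

theorem jaeval_eq_zero_iff (hΦ : IsRepresentation Φ) (hinj : Function.Injective Φ)
    (h : ∀ i, Φ x (e i) = l i • e i) (f : ℝ[X]) :
    jaeval ℝ x f = 0 ↔ ∀ i, f.eval (l i) = 0 := by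
  rw [← aeval_eq_zero_iff_of_diag h, ← hΦ.isJordanHom.map_jaeval, map_eq_zero_iff _ hinj]

variable [Fintype ι]

/-- The map f ↦ f(x) has the same kernel as evaluation at the distinct eigenvalues, and the latter
is onto by Lagrange interpolation. -/
theorem jdegree_eq_card (hΦ : IsRepresentation Φ) (hinj : Function.Injective Φ)
    (h : ∀ i, Φ x (e i) = l i • e i) : jdegree x = (Finset.univ.image l).card := by
  classical
  let ev : ℝ[X] →ₗ[ℝ] (Finset.univ.image l → ℝ) := LinearMap.pi fun a => Polynomial.leval a.1
  have hker : LinearMap.ker (jaeval ℝ x) = LinearMap.ker ev := by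
    ext f
    rw [LinearMap.mem_ker, LinearMap.mem_ker, jaeval_eq_zero_iff hΦ hinj h, funext_iff]
    simp [ev]
  have hsurj : LinearMap.range ev = ⊤ := by
    rw [LinearMap.range_eq_top]
    intro g
    refine ⟨Lagrange.interpolate (Finset.univ.image l) id
      (fun a => if ha : a ∈ Finset.univ.image l then g ⟨a, ha⟩ else 0), ?_⟩
    ext a
    have := Lagrange.eval_interpolate_at_node (s := Finset.univ.image l) (v := id)
      (fun a => if ha : a ∈ Finset.univ.image l then g ⟨a, ha⟩ else 0)
      (Set.injOn_id _) a.2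
    simp only [id] at this
    simp only [ev, LinearMap.pi_apply, Polynomial.leval_apply]
    rw [this, dif_pos a.2]
  rw [jdegree, ← range_jaeval, ← (LinearMap.quotKerEquivRange (jaeval ℝ x)).finrank_eq, hker,
    (LinearMap.quotKerEquivRange ev).finrank_eq, hsurj, finrank_top]
  simp

theorem IsJMinpoly.eq_prod (hΦ : IsRepresentation Φ) (hinj : Function.Injective Φ)
    (h : ∀ i, Φ x (e i) = l i • e i) {f : ℝ[X]} (hf : IsJMinpoly x f) :
    f = ∏ a ∈ Finset.univ.image l, (X - C a) := by
  obtain ⟨hm, hd, h0⟩ := hf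
  rw [← jaeval_apply, jaeval_eq_zero_iff hΦ hinj h] at h0
  rw [jdegree_eq_card hΦ hinj h] at hd
  refine (Polynomial.eq_of_monic_of_dvd_of_natDegree_le
    (Polynomial.monic_prod_X_sub_C (fun a : ℝ => a) _) hm ?_ ?_)
  · refine Finset.prod_dvd_of_coprime (fun a _ b _ hab => ?_) fun a ha => ?_
    · exact Polynomial.isCoprime_X_sub_C_of_isUnit_sub (by simpa [sub_eq_zero] using hab)
    · obtain ⟨i, -, rfl⟩ := Finset.mem_image.1 ha
      exact Polynomial.dvd_iff_isRoot.2 (h0 i)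
  · rw [hd, Polynomial.natDegree_finsetProd_X_sub_C_eq_card]

theorem isJMinpoly_prod (hΦ : IsRepresentation Φ) (hinj : Function.Injective Φ)
    (h : ∀ i, Φ x (e i) = l i • e i) :
    IsJMinpoly x (∏ a ∈ Finset.univ.image l, (X - C a)) := by
  refine ⟨Polynomial.monic_prod_X_sub_C id _, ?_, ?_⟩
  · rw [Polynomial.natDegree_finsetProd_X_sub_C_eq_card, jdegree_eq_card hΦ hinj h]
  · rw [← jaeval_apply, jaeval_eq_zero_iff hΦ hinj h]
    intro i
    rw [Polynomial.eval_prod]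
    exact Finset.prod_eq_zero (Finset.mem_image_of_mem l (Finset.mem_univ i)) (by simp)

/-- In maximal degree the left side is the determinant, which is thus the product of the eigenvalues
of Φ(x), each taken once. -/
theorem IsJMinpoly.neg_one_pow_mul_coeff_zero (hΦ : IsRepresentation Φ)
    (hinj : Function.Injective Φ) (h : ∀ i, Φ x (e i) = l i • e i) {f : ℝ[X]}
    (hf : IsJMinpoly x f) : (-1) ^ jdegree x * f.coeff 0 = ∏ a ∈ Finset.univ.image l, a := by
  rw [hf.eq_prod hΦ hinj h, jdegree_eq_card hΦ hinj h, Polynomial.coeff_zero_eq_eval_zero,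
    Polynomial.eval_prod, ← Finset.prod_const, ← Finset.prod_mul_distrib]
  simp

end Degree

variable (J) in
theorem bddAbove_range_jdegree [Module.Finite ℝ J] :
    BddAbove (Set.range (fun x : J => jdegree x)) :=
  ⟨Module.finrank ℝ J, by rintro _ ⟨x, rfl⟩; exact Submodule.finrank_le _⟩

theorem jdegree_le_jrank [Module.Finite ℝ J] (x : J) : jdegree x ≤ jrank J :=
  le_ciSup (bddAbove_range_jdegree J) x

variable (J) in
theorem exists_jdegree_eq_jrank [Module.Finite ℝ J] : ∃ x : J, jdegree x = jrank J :=
  Nat.sSup_mem (Set.range_nonempty _) (bddAbove_range_jdegree J)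

/-- Distinct eigenvalues of `Φ(x)` are at most `rank J` in number. -/
theorem IsRepresentation.card_eigenvalues_le [Module.Finite ℝ J] [FiniteDimensional ℝ E]
    (hΦ : IsRepresentation Φ) (hinj : Function.Injective Φ) (x : J) (s : Finset ℝ)
    (hs : ∀ a ∈ s, ∃ v : E, v ≠ 0 ∧ Φ x v = a • v) : s.card ≤ jrank J := by
  classical
  obtain ⟨e, l, h⟩ := hΦ.exists_eigenbasis x
  have h' : ∀ i, Φ x (e.toBasis i) = l i • e.toBasis i := by simpa using h
  refine le_trans (Finset.card_le_card ?_)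
    ((jdegree_eq_card hΦ hinj h').symm.le.trans (jdegree_le_jrank x))
  intro a ha
  obtain ⟨v, hv, hav⟩ := hs a ha
  by_contra hn
  apply hv
  -- The product of the X - l i kills Φ(x); applied to the eigenvector v it forces a to be one of
  -- the l i.
  have h0 := (aeval_eq_zero_iff_of_diag h' (∏ b ∈ Finset.univ.image l, (Polynomial.X - Polynomial.C b))).2 (fun i => by
    rw [Polynomial.eval_prod]
    exact Finset.prod_eq_zero (Finset.mem_image_of_mem l (Finset.mem_univ i)) (by simp))
  have h1 := aeval_apply_of_eigen hav (∏ b ∈ Finset.univ.image l, (Polynomial.X - Polynomial.C b))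
  rw [h0, LinearMap.zero_apply, eq_comm, smul_eq_zero] at h1
  refine h1.resolve_left ?_
  rw [Polynomial.eval_prod]
  refine Finset.prod_ne_zero_iff.2 fun b hb => ?_
  rw [Polynomial.eval_sub, Polynomial.eval_X, Polynomial.eval_C, sub_ne_zero]
  rintro rfl
  exact hn hb

end Spectral

/-! ### Peirce decomposition along the spectral idempotents of a regular element -/

section Peirce

variable {J : Type*} [NonAssocCommRing J] [Module ℝ J]
  {E : Type*} [NormedAddCommGroup E] [InnerProductSpace ℝ E]
  {Φ : J →ₗ[ℝ] Module.End ℝ E}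

/-- The witness is the quadratic representation 2c(cv) - c²v, with c² replaced by c. -/
theorem IsRepresentation.exists_sandwich (hΦ : IsRepresentation Φ) {c : J}
    (hc : Φ c * Φ c = Φ c) (v : J) : ∃ w : J, Φ w = Φ c * Φ v * Φ c := by
  refine ⟨(2 : ℝ) • (c * (c * v)) - c * v, ?_⟩
  have h1 : Φ c * (Φ c * Φ v) = Φ c * Φ v := by rw [← mul_assoc, hc]
  simp only [map_sub, map_smul, hΦ.map_mul, smul_add, mul_smul_comm, smul_mul_assoc, mul_add,
    add_mul, mul_assoc, h1, hc]
  module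

theorem IsRepresentation.exists_offdiag (hΦ : IsRepresentation Φ) {c d : J}
    (hcd : Φ c * Φ d = 0) (hdc : Φ d * Φ c = 0) (v : J) :
    ∃ w : J, Φ w = Φ c * Φ v * Φ d + Φ d * Φ v * Φ c := by
  refine ⟨(4 : ℝ) • (d * (c * v)), ?_⟩
  have h1 : Φ d * (Φ c * Φ v) = 0 := by rw [← mul_assoc, hdc, zero_mul]
  simp only [map_smul, hΦ.map_mul, smul_add, mul_smul_comm, smul_mul_assoc, mul_add,
    add_mul, mul_assoc, h1, hcd, mul_zero]
  module

variable [FiniteDimensional ℝ E]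

theorem IsRepresentation.exists_eigenvector_ne_zero (hΦ : IsRepresentation Φ) {y : J}
    (hy : Φ y ≠ 0) : ∃ (s : ℝ) (v : E), s ≠ 0 ∧ v ≠ 0 ∧ Φ y v = s • v := by
  obtain ⟨e, l, h⟩ := hΦ.exists_eigenbasis y
  by_contra hn
  apply hy
  refine e.toBasis.ext fun i => ?_
  rw [e.coe_toBasis, h, LinearMap.zero_apply]
  by_contra h0
  refine hn ⟨l i, e i, ?_, e.orthonormal.ne_zero i, h i⟩
  rintro h1
  simp [h1] at h0

variable {x : J} {ι : Type*} [Fintype ι] {e : OrthonormalBasis ι ℝ E} {l : ι → ℝ}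

omit [FiniteDimensional ℝ E] in
-- Evaluate at x the Lagrange polynomial that is 1 at a and 0 at the other eigenvalues. When a is
-- not an eigenvalue the result acts as 0.
theorem IsRepresentation.exists_spectral_idempotent (hΦ : IsRepresentation Φ)
    (h : ∀ i, Φ x (e i) = l i • e i) (a : ℝ) :
    ∃ c : J, ∀ i, Φ c (e i) = if l i = a then e i else 0 := by
  classical
  refine ⟨jaeval ℝ x (Lagrange.interpolate (Finset.univ.image l) id
      (fun b => if b = a then 1 else 0)), fun i => ?_⟩
  rw [hΦ.isJordanHom.map_jaeval, aeval_apply_of_eigen (h i)]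
  have := Lagrange.eval_interpolate_at_node (s := Finset.univ.image l) (v := id)
      (fun b => if b = a then (1 : ℝ) else 0) (Set.injOn_id _)
      (Finset.mem_image_of_mem l (Finset.mem_univ i))
  simp only [id] at this
  rw [this]
  split_ifs <;> simp

variable {c : ℝ → J}

omit [FiniteDimensional ℝ E] in
theorem idempotent_mul (hc : ∀ a i, Φ (c a) (e i) = if l i = a then e i else 0) (a b : ℝ) :
    Φ (c a) * Φ (c b) = if a = b then Φ (c a) else 0 := by
  refine e.toBasis.ext fun i => ?_
  rw [Module.End.mul_apply, e.coe_toBasis, hc]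
  by_cases hb : l i = b
  · rw [if_pos hb, hc]
    subst hb
    by_cases ha : l i = a
    · rw [if_pos ha, if_pos ha.symm, hc, if_pos ha]
    · rw [if_neg ha, if_neg (Ne.symm ha), LinearMap.zero_apply]
  · rw [if_neg hb, map_zero]
    by_cases hab : a = b
    · subst hab
      rw [if_pos rfl, hc, if_neg hb]
    · rw [if_neg hab, LinearMap.zero_apply]

omit [FiniteDimensional ℝ E] in
theorem sum_idempotent (hc : ∀ a i, Φ (c a) (e i) = if l i = a then e i else 0) :
    ∑ a ∈ Finset.univ.image l, Φ (c a) = 1 := by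
  refine e.toBasis.ext fun i => ?_
  simp [LinearMap.sum_apply, hc]

omit [FiniteDimensional ℝ E] in
theorem idempotent_ne_zero (hc : ∀ a i, Φ (c a) (e i) = if l i = a then e i else 0) (i : ι) :
    Φ (c (l i)) ≠ 0 := by
  intro h
  have := hc (l i) i
  rw [h, if_pos rfl, LinearMap.zero_apply] at this
  exact e.orthonormal.ne_zero i this.symm

omit [FiniteDimensional ℝ E] in
theorem trace_idempotent (hc : ∀ a i, Φ (c a) (e i) = if l i = a then e i else 0) (a : ℝ) :
    LinearMap.trace ℝ E (Φ (c a)) = (Finset.univ.filter fun i => l i = a).card := by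
  rw [LinearMap.trace_eq_sum_inner _ e, Finset.card_filter]
  push_cast
  refine Finset.sum_congr rfl fun i _ => ?_
  rw [hc]
  split_ifs <;> simp

variable [Module.Finite ℝ J]

/-- The spectral idempotents of an element of maximal degree are primitive. -/
theorem IsRepresentation.eq_smul_idempotent (hΦ : IsRepresentation Φ)
    (hinj : Function.Injective Φ) (h : ∀ i, Φ x (e i) = l i • e i) (hx : jdegree x = jrank J)
    (hc : ∀ a i, Φ (c a) (e i) = if l i = a then e i else 0) (i : ι) {y : J}
    (hy : Φ (c (l i)) * Φ y * Φ (c (l i)) = Φ y) : ∃ s : ℝ, Φ y = s • Φ (c (l i)) := by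
  classical
  set a := l i with ha
  set P := Φ (c a) with hP
  have hPP : P * P = P := by rw [hP, idempotent_mul hc, if_pos rfl]
  have hPx : ∀ v, P v = v → Φ x v = a • v := by
    intro v hv
    have : Φ x * P = a • P := by
      refine e.toBasis.ext fun j => ?_
      rw [Module.End.mul_apply, LinearMap.smul_apply, e.coe_toBasis, hP, hc]
      split_ifs with hj
      · rw [h, hj]
      · simp
    have := LinearMap.congr_fun this v
    rwa [Module.End.mul_apply, LinearMap.smul_apply, hv] at this
  by_cases hy0 : Φ y = 0
  · exact ⟨0, by simp [hy0]⟩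
  obtain ⟨s, v, hs, hv, hsv⟩ := hΦ.exists_eigenvector_ne_zero hy0
  -- Eigenvectors with nonzero eigenvalue of an operator fixed by left multiplication by P lie in
  -- the range of P.
  have key : ∀ (z : J) (_ : P * Φ z = Φ z) (s : ℝ) (v : E), s ≠ 0 → Φ z v = s • v → P v = v := by
    intro z hz s v hs hsv
    have h1 := LinearMap.congr_fun hz v
    rw [Module.End.mul_apply, hsv, map_smul] at h1
    exact smul_right_injective E hs h1
  have hPy : P * Φ y = Φ y := by
    rw [← hy, ← mul_assoc, ← mul_assoc, hPP]
  have hyP : Φ y * P = Φ y := by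
    rw [← hy, mul_assoc, hPP]
  have hPv := key y hPy s v hs hsv
  refine ⟨s, ?_⟩
  -- Otherwise Φ(y) has two distinct eigenvalues s and s + b on the range of P. Replacing x by y on
  -- that range then raises the number of eigenvalues to r + 1, against the maximality of r.
  by_contra hne
  have hz0 : Φ (y - s • c a) ≠ 0 := by
    rwa [map_sub, map_smul, sub_ne_zero]
  obtain ⟨b, w, hb, hw, hbw⟩ := hΦ.exists_eigenvector_ne_zero hz0
  have hPw : P w = w := by
    refine key _ ?_ b w hb hbw
    rw [map_sub, map_smul, mul_sub, hPy, mul_smul_comm, hPP]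
  have hyw : Φ y w = (s + b) • w := by
    rw [map_sub, map_smul, LinearMap.sub_apply, LinearMap.smul_apply, ← hP, hPw] at hbw
    rw [add_smul, ← hbw]; abel
  obtain ⟨t, ht⟩ := Infinite.exists_notMem_finset
    ((Finset.univ.image fun j => s - l j) ∪ (Finset.univ.image fun j => s + b - l j))
  have ht1 : ∀ j, l j + t ≠ s := by
    intro j hj
    exact ht (Finset.mem_union_left _ (Finset.mem_image.2 ⟨j, Finset.mem_univ _, by linarith⟩))
  have ht2 : ∀ j, l j + t ≠ s + b := by
    intro j hj
    exact ht (Finset.mem_union_right _ (Finset.mem_image.2 ⟨j, Finset.mem_univ _, by linarith⟩))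
  -- This acts as Φ(y) on the range of P and as Φ(x) + t on its complement; t is chosen to keep the
  -- two sets of eigenvalues apart.
  set x' : J := y + x - a • c a + t • (1 - c a) with hx'
  have hx'1 : ∀ v, P v = v → Φ x' v = Φ y v := by
    intro v hv
    rw [hx']
    simp only [map_add, map_sub, map_smul, hΦ.map_one, LinearMap.add_apply, LinearMap.sub_apply,
      LinearMap.smul_apply, Module.End.one_apply, ← hP, hv, hPx v hv]
    simp
  have hle := hΦ.card_eigenvalues_le hinj x'
    ({s, s + b} ∪ ((Finset.univ.image l).erase a).image (· + t)) (by
      intro m hm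
      rcases Finset.mem_union.1 hm with hm | hm
      · rcases Finset.mem_insert.1 hm with rfl | hm
        · exact ⟨v, hv, by rw [hx'1 v hPv, hsv]⟩
        · rw [Finset.mem_singleton] at hm
          subst hm
          exact ⟨w, hw, by rw [hx'1 w hPw, hyw]⟩
      · obtain ⟨m', hm', rfl⟩ := Finset.mem_image.1 hm
        obtain ⟨hne', hm''⟩ := Finset.mem_erase.1 hm'
        obtain ⟨j, -, rfl⟩ := Finset.mem_image.1 hm''
        refine ⟨e j, e.orthonormal.ne_zero j, ?_⟩
        have hPj : P (e j) = 0 := by rw [hP, hc, if_neg hne']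
        have hyj : Φ y (e j) = 0 := by
          rw [← hyP, Module.End.mul_apply, hPj, map_zero]
        rw [hx']
        simp only [map_add, map_sub, map_smul, hΦ.map_one, LinearMap.add_apply,
          LinearMap.sub_apply, LinearMap.smul_apply, Module.End.one_apply, ← hP, hPj, hyj, h]
        module)
  have hdisj : Disjoint ({s, s + b} : Finset ℝ)
      (((Finset.univ.image l).erase a).image (· + t)) := by
    rw [Finset.disjoint_left]
    rintro m hm hm'
    obtain ⟨m', hm'', rfl⟩ := Finset.mem_image.1 hm'
    obtain ⟨j, -, rfl⟩ := Finset.mem_image.1 (Finset.mem_of_mem_erase hm'')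
    rcases Finset.mem_insert.1 hm with hm | hm
    · exact ht1 j hm
    · exact ht2 j (Finset.mem_singleton.1 hm)
  have hcard : (Finset.univ.image l).card = jrank J := by
    rw [← hx, jdegree_eq_card hΦ hinj (e := e.toBasis) (l := l) (by simpa using h)]
  have hpos : 0 < (Finset.univ.image l).card :=
    Finset.card_pos.2 ⟨a, Finset.mem_image_of_mem l (Finset.mem_univ i)⟩
  rw [Finset.card_union_of_disjoint hdisj, Finset.card_pair (by simpa using hb),
    Finset.card_image_of_injective _ (add_left_injective t),
    Finset.card_erase_of_mem (Finset.mem_image_of_mem l (Finset.mem_univ i)), hcard] at hle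
  omega

/-- Spectral idempotents linked by a nonzero Peirce component have the same multiplicity. -/
theorem IsRepresentation.trace_idempotent_eq (hΦ : IsRepresentation Φ)
    (hinj : Function.Injective Φ) (h : ∀ i, Φ x (e i) = l i • e i) (hx : jdegree x = jrank J)
    (hc : ∀ a i, Φ (c a) (e i) = if l i = a then e i else 0) (i j : ι) (hij : l i ≠ l j) {y : J}
    (hy : Φ (c (l i)) * Φ y * Φ (c (l j)) ≠ 0) :
    LinearMap.trace ℝ E (Φ (c (l i))) = LinearMap.trace ℝ E (Φ (c (l j))) := by
  have hAB : Φ (c (l i)) * Φ (c (l j)) = 0 := by rw [idempotent_mul hc, if_neg hij]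
  have hBA : Φ (c (l j)) * Φ (c (l i)) = 0 := by rw [idempotent_mul hc, if_neg hij.symm]
  have hAA : Φ (c (l i)) * Φ (c (l i)) = Φ (c (l i)) := by rw [idempotent_mul hc, if_pos rfl]
  have hBB : Φ (c (l j)) * Φ (c (l j)) = Φ (c (l j)) := by rw [idempotent_mul hc, if_pos rfl]
  have hprimA := fun z => hΦ.eq_smul_idempotent hinj h hx hc i (y := z)
  have hprimB := fun z => hΦ.eq_smul_idempotent hinj h hx hc j (y := z)
  -- Below A, B, Y stand for the two idempotents and Φ(y), so that Φ(u) = AYB + BYA. The diagonal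
  -- blocks of Φ(u)² are AYBYA and BYAYB; primitivity makes them αA and βB.
  obtain ⟨u, hu⟩ := hΦ.exists_offdiag hAB hBA y
  obtain ⟨wA, hwA⟩ := hΦ.exists_sandwich hAA (u * u)
  obtain ⟨wB, hwB⟩ := hΦ.exists_sandwich hBB (u * u)
  have symA := hΦ.symm (c (l i))
  have symB := hΦ.symm (c (l j))
  have symY := hΦ.symm y
  rw [hΦ.map_sq, hu] at hwA hwB
  generalize Φ (c (l i)) = A at *
  generalize Φ (c (l j)) = B at *
  generalize Φ y = Y at *
  have l1 : ∀ Z, A * (A * Z) = A * Z := fun Z => by rw [← mul_assoc, hAA]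
  have l2 : ∀ Z, B * (B * Z) = B * Z := fun Z => by rw [← mul_assoc, hBB]
  have l3 : ∀ Z, A * (B * Z) = 0 := fun Z => by rw [← mul_assoc, hAB, zero_mul]
  have l4 : ∀ Z, B * (A * Z) = 0 := fun Z => by rw [← mul_assoc, hBA, zero_mul]
  simp only [mul_add, add_mul, mul_assoc, l1, l2, l3, l4, hAA, hBB, mul_zero, add_zero,
    zero_add] at hwA hwB
  obtain ⟨α, hα⟩ := hprimA wA (by rw [hwA]; simp only [mul_assoc, l1, hAA])
  obtain ⟨β, hβ⟩ := hprimB wB (by rw [hwB]; simp only [mul_assoc, l2, hBB])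
  rw [hwA] at hα
  rw [hwB] at hβ
  -- Associate AYBYAYB in two ways.
  have hαβ : α = β := by
    have h1 : (A * (Y * (B * (Y * A)))) * (Y * B) = (A * Y) * (B * (Y * (A * (Y * B)))) := by
      simp only [mul_assoc]
    rw [hα, hβ, smul_mul_assoc, mul_smul_comm, mul_assoc, ← mul_assoc, ← sub_eq_zero,
      ← sub_smul, smul_eq_zero] at h1
    exact sub_eq_zero.1 (h1.resolve_right hy)
  -- AYBYA is the product of BYA with its adjoint, so it vanishes only if BYA does, and with it AYB.
  have hα0 : α ≠ 0 := by
    rintro rfl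
    apply hy
    rw [zero_smul] at hα
    have h2 : ∀ v, B (Y (A v)) = 0 := by
      intro v
      have h3 := LinearMap.congr_fun hα v
      simp only [Module.End.mul_apply, LinearMap.zero_apply] at h3
      have h4 : inner ℝ (B (Y (A v))) (B (Y (A v))) = 0 := by
        rw [symB, symY, symA, ← Module.End.mul_apply B B, hBB, h3, inner_zero_right]
      exact inner_self_eq_zero.1 h4
    ext v
    refine ext_inner_right ℝ fun w => ?_
    simp only [Module.End.mul_apply]
    rw [symA, symY, symB, h2]
    simp
  have htr : LinearMap.trace ℝ E (A * (Y * (B * (Y * A))))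
      = LinearMap.trace ℝ E (B * (Y * (A * (Y * B)))) := by
    have := LinearMap.trace_mul_comm ℝ (A * (Y * B)) (B * (Y * A))
    simpa only [mul_assoc, l1, l2] using this
  rw [hα, hβ, map_smul, map_smul, ← hαβ] at htr
  exact smul_right_injective ℝ hα0 htr

/-- In a simple Jordan algebra all spectral idempotents of an element of maximal degree have the
same multiplicity. -/
theorem IsRepresentation.trace_idempotent_const [IsSimpleRing J] (hΦ : IsRepresentation Φ)
    (hinj : Function.Injective Φ) (h : ∀ i, Φ x (e i) = l i • e i) (hx : jdegree x = jrank J)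
    (hc : ∀ a i, Φ (c a) (e i) = if l i = a then e i else 0) (i j : ι) :
    LinearMap.trace ℝ E (Φ (c (l i))) = LinearMap.trace ℝ E (Φ (c (l j))) := by
  classical
  set m : ℝ → ℝ := fun a => LinearMap.trace ℝ E (Φ (c a)) with hm
  -- P collects the idempotents with the same trace as the i-th one. The Peirce components between P
  -- and Q = 1 - P vanish, so P commutes with Φ(J) and cuts out an ideal; simplicity leaves no room
  -- for Q.
  set S := (Finset.univ.image l).filter fun a => m a = m (l i) with hS
  set P := ∑ a ∈ S, Φ (c a) with hP
  set Q := ∑ a ∈ (Finset.univ.image l).filter fun a => ¬ m a = m (l i), Φ (c a) with hQ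
  have hPQ : P + Q = 1 := by
    rw [hP, hQ, hS, Finset.sum_filter_add_sum_filter_not, sum_idempotent hc]
  have hzero : ∀ y a b, a ∈ Finset.univ.image l → b ∈ Finset.univ.image l →
      m a ≠ m b → Φ (c a) * Φ y * Φ (c b) = 0 := by
    intro y a b ha hb hab
    obtain ⟨i', -, rfl⟩ := Finset.mem_image.1 ha
    obtain ⟨j', -, rfl⟩ := Finset.mem_image.1 hb
    by_contra hne
    exact hab (hΦ.trace_idempotent_eq hinj h hx hc i' j' (fun hh => hab (by rw [hh])) hne)
  have hPyQ : ∀ y, P * Φ y * Q = 0 := by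
    intro y
    rw [hP, hQ, Finset.sum_mul, Finset.sum_mul]
    refine Finset.sum_eq_zero fun a ha => ?_
    rw [Finset.mul_sum]
    refine Finset.sum_eq_zero fun b hb => ?_
    obtain ⟨ha1, ha2⟩ := Finset.mem_filter.1 ha
    obtain ⟨hb1, hb2⟩ := Finset.mem_filter.1 hb
    exact hzero y a b ha1 hb1 (by rw [ha2]; exact Ne.symm hb2)
  have hQyP : ∀ y, Q * Φ y * P = 0 := by
    intro y
    rw [hP, hQ, Finset.sum_mul, Finset.sum_mul]
    refine Finset.sum_eq_zero fun a ha => ?_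
    rw [Finset.mul_sum]
    refine Finset.sum_eq_zero fun b hb => ?_
    obtain ⟨ha1, ha2⟩ := Finset.mem_filter.1 ha
    obtain ⟨hb1, hb2⟩ := Finset.mem_filter.1 hb
    exact hzero y a b ha1 hb1 (by rw [hb2]; exact ha2)
  have hcomm : ∀ y, P * Φ y = Φ y * P := by
    intro y
    have h1 : P * Φ y = P * Φ y * P := by
      conv_lhs => rw [← mul_one (P * Φ y), ← hPQ, mul_add, hPyQ, add_zero]
    have h2 : Φ y * P = P * Φ y * P := by
      conv_lhs => rw [← one_mul (Φ y * P), ← hPQ, add_mul, ← mul_assoc, ← mul_assoc, hQyP,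
        add_zero]
    rw [h1, h2]
  have hmulP : ∀ {y z : J}, P * Φ z = Φ z → P * Φ (y * z) = Φ (y * z) := by
    intro y z hz
    rw [hΦ.map_mul, mul_smul_comm, mul_add, ← mul_assoc, ← mul_assoc, hz, hcomm y, mul_assoc, hz]
  let I : TwoSidedIdeal J := TwoSidedIdeal.mk' {y | P * Φ y = Φ y} (by simp)
    (fun {y z} hy hz => by
      simp only [Set.mem_ofPred_eq] at *
      rw [map_add, mul_add, hy, hz])
    (fun {y} hy => by
      simp only [Set.mem_ofPred_eq] at *
      rw [map_neg, mul_neg, hy])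
    (fun {y z} hz => hmulP hz)
    (fun {y z} hy => by
      rw [mul_comm]
      exact hmulP hy)
  have hmem : ∀ y, y ∈ I ↔ P * Φ y = Φ y := fun y => TwoSidedIdeal.mem_mk' _ _ _ _ _ _ _
  have hPc : ∀ a, P * Φ (c a) = if a ∈ S then Φ (c a) else 0 := by
    intro a
    rw [hP, Finset.sum_mul]
    simp only [idempotent_mul hc]
    split_ifs with ha
    · rw [Finset.sum_eq_single a]
      · simp
      · intro b _ hb; rw [if_neg hb]
      · intro hn; exact absurd ha hn
    · refine Finset.sum_eq_zero fun b hb => if_neg ?_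
      rintro rfl; exact ha hb
  have hIne : I ≠ ⊥ := by
    intro hbot
    have h1 : c (l i) ∈ I := by
      rw [hmem, hPc, if_pos]
      exact Finset.mem_filter.2 ⟨Finset.mem_image_of_mem l (Finset.mem_univ i), rfl⟩
    rw [hbot, TwoSidedIdeal.mem_bot] at h1
    exact idempotent_ne_zero hc i (by rw [h1, map_zero])
  have htop : I = ⊤ := (eq_bot_or_eq_top I).resolve_left hIne
  have h1 : c (l j) ∈ I := by rw [htop]; trivial
  rw [hmem, hPc] at h1
  split_ifs at h1 with h2
  · exact (Finset.mem_filter.1 h2).2.symm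
  · exact absurd h1.symm (idempotent_ne_zero hc j)

/-- The multiplicities of the eigenvalues of `Φ(x)`, `x` of maximal degree, are all equal to
`dim E / rank J`. -/
theorem IsRepresentation.card_fiber_mul_jrank [IsSimpleRing J] (hΦ : IsRepresentation Φ)
    (hinj : Function.Injective Φ) (h : ∀ i, Φ x (e i) = l i • e i) (hx : jdegree x = jrank J)
    (i : ι) :
    (Finset.univ.filter fun j => l j = l i).card * jrank J = Module.finrank ℝ E := by
  classical
  choose c hc using hΦ.exists_spectral_idempotent h
  have hcard : (Finset.univ.image l).card = jrank J := by
    rw [← hx, jdegree_eq_card hΦ hinj (e := e.toBasis) (l := l) (by simpa using h)]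
  have hcf : ∀ j, (Finset.univ.filter fun k => l k = l j).card
      = (Finset.univ.filter fun k => l k = l i).card := by
    intro j
    have := hΦ.trace_idempotent_const hinj h hx hc j i
    rw [trace_idempotent hc, trace_idempotent hc] at this
    exact_mod_cast this
  have hcf' : ∀ a ∈ Finset.univ.image l, (Finset.univ.filter fun k => l k = a).card
      = (Finset.univ.filter fun k => l k = l i).card := by
    intro a ha
    obtain ⟨j, -, rfl⟩ := Finset.mem_image.1 ha
    exact hcf j
  rw [Module.finrank_eq_card_basis e.toBasis, ← Finset.card_univ,
    Finset.card_eq_sum_card_image l Finset.univ, Finset.sum_congr rfl hcf', Finset.sum_const,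
    hcard, smul_eq_mul, mul_comm]

theorem IsRepresentation.det_eq_prod_pow [IsSimpleRing J] (hΦ : IsRepresentation Φ)
    (hinj : Function.Injective Φ) (h : ∀ i, Φ x (e i) = l i • e i) (hx : jdegree x = jrank J)
    {k : ℕ} (hk : k * jrank J = Module.finrank ℝ E) (hr : 0 < jrank J) :
    LinearMap.det (Φ x) = (∏ a ∈ Finset.univ.image l, a) ^ k := by
  classical
  have hdiag : LinearMap.toMatrix e.toBasis e.toBasis (Φ x) = Matrix.diagonal l := by
    ext i j
    rw [LinearMap.toMatrix_apply, e.coe_toBasis, h, map_smul, ← e.coe_toBasis,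
      Module.Basis.repr_self, Matrix.diagonal_apply]
    by_cases hij : i = j
    · subst hij; simp
    · simp [hij]
  rw [← LinearMap.det_toMatrix e.toBasis, hdiag, Matrix.det_diagonal,
    ← Finset.prod_fiberwise_of_maps_to (g := l)
      (fun i _ => Finset.mem_image_of_mem l (Finset.mem_univ i)) l, ← Finset.prod_pow]
  refine Finset.prod_congr rfl fun a ha => ?_
  obtain ⟨j, -, rfl⟩ := Finset.mem_image.1 ha
  rw [Finset.prod_congr rfl (fun i hi => (Finset.mem_filter.1 hi).2), Finset.prod_const]
  congr 1
  exact Nat.eq_of_mul_eq_mul_right hr ((hΦ.card_fiber_mul_jrank hinj h hx j).trans hk.symm)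

end Peirce

/-! ### The determinant polynomial -/

section HankelGram

variable {ι : Type*} [Fintype ι]

/-- The Gram matrix of the power functions on a finite family of points. -/
def powerGram (l : ι → ℝ) (r : ℕ) : Matrix (Fin r) (Fin r) ℝ :=
  fun i j => ∑ k, l k ^ ((i : ℕ) + j)

theorem powerGram_mulVec (l : ι → ℝ) (r : ℕ) (v : Fin r → ℝ) (i : Fin r) :
    (powerGram l r).mulVec v i = ∑ k, l k ^ (i : ℕ) * ∑ j, v j * l k ^ (j : ℕ) := by
  simp only [Matrix.mulVec, dotProduct, powerGram, Finset.sum_mul, Finset.mul_sum]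
  rw [Finset.sum_comm]
  refine Finset.sum_congr rfl fun k _ => Finset.sum_congr rfl fun j _ => ?_
  ring

theorem sum_coeff_mul_pow {f : Polynomial ℝ} {r : ℕ} (hf : f.natDegree < r) (a : ℝ) :
    ∑ j : Fin r, f.coeff j * a ^ (j : ℕ) = f.eval a := by
  rw [Polynomial.eval_eq_sum_range' hf, Finset.sum_range]

/-- A Gram matrix is singular exactly when its functions are dependent. Here that means that a
nonzero polynomial of degree less than r vanishes at all the points, which requires fewer than r
distinct points. -/
theorem det_powerGram_ne_zero_iff (l : ι → ℝ) (r : ℕ) :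
    (powerGram l r).det ≠ 0 ↔ r ≤ (Finset.univ.image l).card := by
  classical
  rw [Ne, ← Matrix.exists_mulVec_eq_zero_iff, not_iff_comm, not_le]
  constructor
  · intro hlt
    set q : Polynomial ℝ := ∏ a ∈ Finset.univ.image l, (Polynomial.X - Polynomial.C a) with hq
    have hdeg : q.natDegree = (Finset.univ.image l).card :=
      Polynomial.natDegree_finsetProd_X_sub_C_eq_card _ (fun a : ℝ => a)
    refine ⟨fun j => q.coeff j, ?_, ?_⟩
    · intro h0
      have hm : q.Monic := Polynomial.monic_prod_X_sub_C (fun a : ℝ => a) _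
      have h1 := congr_fun h0 ⟨q.natDegree, hdeg ▸ hlt⟩
      simp only [Polynomial.coeff_natDegree, hm.leadingCoeff, Pi.zero_apply] at h1
      exact one_ne_zero h1
    · ext i
      rw [powerGram_mulVec, Pi.zero_apply]
      refine Finset.sum_eq_zero fun k _ => ?_
      rw [sum_coeff_mul_pow (hdeg ▸ hlt), hq, Polynomial.eval_prod,
        Finset.prod_eq_zero (Finset.mem_image_of_mem l (Finset.mem_univ k)) (by simp), mul_zero]
  · rintro ⟨v, hv, hGv⟩
    by_contra hle
    rw [not_lt] at hle
    apply hv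
    -- The quadratic form of the matrix at v is the sum of the squares of the values at the points
    -- of the polynomial with coefficients v.
    have hsum : ∑ k, (∑ j, v j * l k ^ (j : ℕ)) ^ 2 = 0 := by
      have h1 : ∑ i, v i * (powerGram l r).mulVec v i = 0 := by simp [hGv]
      rw [← h1]
      simp only [powerGram_mulVec, Finset.mul_sum]
      rw [Finset.sum_comm]
      refine Finset.sum_congr rfl fun k _ => ?_
      rw [sq, Finset.sum_mul_sum]
      refine Finset.sum_congr rfl fun i _ => Finset.sum_congr rfl fun j _ => ?_
      ring
    have hz : ∀ k, ∑ j, v j * l k ^ (j : ℕ) = 0 := by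
      intro k
      have := (Finset.sum_eq_zero_iff_of_nonneg (fun k _ => sq_nonneg _)).1 hsum k
        (Finset.mem_univ k)
      exact pow_eq_zero_iff two_ne_zero |>.1 this
    set q : Polynomial ℝ := ∑ j : Fin r, Polynomial.monomial (j : ℕ) (v j) with hq
    have hqdeg : q.degree < r := by
      rw [Polynomial.degree_lt_iff_coeff_zero]
      intro m hm
      rw [hq, Polynomial.finsetSum_coeff]
      refine Finset.sum_eq_zero fun j _ => ?_
      rw [Polynomial.coeff_monomial, if_neg (j.2.trans_le hm).ne]
    have hq0 : q = 0 := by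
      refine Polynomial.eq_zero_of_degree_lt_of_eval_finset_eq_zero (Finset.univ.image l)
        (hqdeg.trans_le (by exact_mod_cast hle)) ?_
      intro a ha
      obtain ⟨k, -, rfl⟩ := Finset.mem_image.1 ha
      rw [hq, Polynomial.eval_finsetSum]
      simpa [Polynomial.eval_monomial] using hz k
    ext j
    have h2 : q.coeff j = v j := by
      rw [hq, Polynomial.finsetSum_coeff]
      simp [Polynomial.coeff_monomial, Fin.val_inj]
    rw [← h2, hq0, Polynomial.coeff_zero, Pi.zero_apply]

/-- The lower coefficients of the minimal polynomial solve a linear system whose matrix and right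
side are power sums, hence polynomial in x. Cramer's rule then applies. -/
theorem powerGram_mulVec_coeff {l : ι → ℝ} {f : Polynomial ℝ} (hf : f.Monic)
    (h0 : ∀ k, f.eval (l k) = 0) (i : Fin f.natDegree) :
    (powerGram l f.natDegree).mulVec (fun j => f.coeff j) i
      = -∑ k, l k ^ ((i : ℕ) + f.natDegree) := by
  rw [powerGram_mulVec, ← Finset.sum_neg_distrib]
  refine Finset.sum_congr rfl fun k _ => ?_
  have h1 := h0 k
  rw [Polynomial.eval_eq_sum_range, Finset.sum_range_succ, Finset.sum_range,
    Polynomial.coeff_natDegree, hf.leadingCoeff, one_mul] at h1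
  rw [eq_neg_of_add_eq_zero_left h1, pow_add]
  ring

end HankelGram

/-! ### The determinant as a polynomial, and its relation to det Φ. -/

section GenericMatrix

variable {J : Type*} [NonAssocCommRing J] [Module ℝ J] [Module.Finite ℝ J]
  {E : Type*} [NormedAddCommGroup E] [InnerProductSpace ℝ E] [FiniteDimensional ℝ E]

open MvPolynomial

/-- The matrix of `Φ` at the generic element of `J`. -/
def genericMatrix (Φ : J →ₗ[ℝ] Module.End ℝ E) :
    Matrix (Fin (Module.finrank ℝ E)) (Fin (Module.finrank ℝ E))
      (MvPolynomial (Fin (Module.finrank ℝ J)) ℝ) :=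
  fun a b => ∑ i, X i * C (LinearMap.toMatrix (stdOrthonormalBasis ℝ E).toBasis
    (stdOrthonormalBasis ℝ E).toBasis (Φ (Module.finBasis ℝ J i)) a b)

/-- The polynomial `x ↦ det Φ(x)`. -/
def repDetPoly (Φ : J →ₗ[ℝ] Module.End ℝ E) : MvPolynomial (Fin (Module.finrank ℝ J)) ℝ :=
  (genericMatrix Φ).det

/-- The discriminant-like polynomial whose nonvanishing characterizes maximal degree. -/
def gramMatrix (Φ : J →ₗ[ℝ] Module.End ℝ E) :
    Matrix (Fin (jrank J)) (Fin (jrank J)) (MvPolynomial (Fin (Module.finrank ℝ J)) ℝ) :=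
  fun i j => (genericMatrix Φ ^ ((i : ℕ) + j)).trace

variable {Φ : J →ₗ[ℝ] Module.End ℝ E}

theorem genericMatrix_map_eval (x : J) :
    (genericMatrix Φ).map (eval fun i => (Module.finBasis ℝ J).repr x i)
      = LinearMap.toMatrix (stdOrthonormalBasis ℝ E).toBasis
          (stdOrthonormalBasis ℝ E).toBasis (Φ x) := by
  ext a b
  conv_rhs => rw [← (Module.finBasis ℝ J).sum_repr x]
  simp only [genericMatrix, Matrix.map_apply, map_sum, map_mul, eval_X, eval_C, map_smul,
    Matrix.sum_apply, Matrix.smul_apply, smul_eq_mul]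

theorem eval_repDetPoly (x : J) :
    eval (fun i => (Module.finBasis ℝ J).repr x i) (repDetPoly Φ) = LinearMap.det (Φ x) := by
  rw [repDetPoly, RingHom.map_det, RingHom.mapMatrix_apply, genericMatrix_map_eval,
    LinearMap.det_toMatrix]

variable {x : J} {ι : Type*} [Fintype ι] {e : OrthonormalBasis ι ℝ E} {l : ι → ℝ}

theorem eval_trace_genericMatrix_pow (h : ∀ i, Φ x (e i) = l i • e i) (n : ℕ) :
    eval (fun i => (Module.finBasis ℝ J).repr x i) (genericMatrix Φ ^ n).trace
      = ∑ k, l k ^ n := by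
  have h1 : eval (fun i => (Module.finBasis ℝ J).repr x i) (genericMatrix Φ ^ n).trace
      = LinearMap.trace ℝ E (Φ x ^ n) := by
    rw [AddMonoidHom.map_trace, ← RingHom.mapMatrix_apply, map_pow, RingHom.mapMatrix_apply,
      genericMatrix_map_eval, LinearMap.toMatrix_pow,
      ← LinearMap.trace_eq_matrix_trace]
  rw [h1, LinearMap.trace_eq_sum_inner _ e]
  refine Finset.sum_congr rfl fun k _ => ?_
  have := aeval_apply_of_eigen (h k) (Polynomial.X ^ n)
  simp only [map_pow, Polynomial.aeval_X, Polynomial.eval_pow, Polynomial.eval_X] at this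
  rw [this, inner_smul_right, real_inner_self_eq_norm_sq, e.norm_eq_one]
  ring

theorem gramMatrix_map_eval (h : ∀ i, Φ x (e i) = l i • e i) :
    (gramMatrix Φ).map (eval fun i => (Module.finBasis ℝ J).repr x i) = powerGram l (jrank J) := by
  ext i j
  simp only [gramMatrix, Matrix.map_apply, powerGram, eval_trace_genericMatrix_pow h]

theorem eval_gramMatrix_det (h : ∀ i, Φ x (e i) = l i • e i) :
    eval (fun i => (Module.finBasis ℝ J).repr x i) (gramMatrix Φ).det
      = (powerGram l (jrank J)).det := by
  rw [RingHom.map_det, RingHom.mapMatrix_apply, gramMatrix_map_eval h]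

theorem IsRepresentation.eval_gramMatrix_det_ne_zero_iff (hΦ : IsRepresentation Φ)
    (hinj : Function.Injective Φ) (x : J) :
    eval (fun i => (Module.finBasis ℝ J).repr x i) (gramMatrix Φ).det ≠ 0
      ↔ jdegree x = jrank J := by
  obtain ⟨e, l, h⟩ := hΦ.exists_eigenbasis x
  rw [eval_gramMatrix_det h, det_powerGram_ne_zero_iff,
    ← jdegree_eq_card hΦ hinj (e := e.toBasis) (l := l) (by simpa using h)]
  exact ⟨fun h => le_antisymm (jdegree_le_jrank x) h, fun h => h.symm.le⟩

theorem IsRepresentation.gramMatrix_det_ne_zero (hΦ : IsRepresentation Φ)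
    (hinj : Function.Injective Φ) : (gramMatrix Φ).det ≠ 0 := by
  obtain ⟨x, hx⟩ := exists_jdegree_eq_jrank J
  intro h0
  exact (hΦ.eval_gramMatrix_det_ne_zero_iff hinj x).2 hx (by rw [h0, map_zero])

/-- Polynomials that agree on the elements of maximal degree are equal. -/
theorem IsRepresentation.eq_of_eval_eq (hΦ : IsRepresentation Φ)
    (hinj : Function.Injective Φ) {p q : MvPolynomial (Fin (Module.finrank ℝ J)) ℝ}
    (hpq : ∀ x : J, jdegree x = jrank J →
      eval (fun i => (Module.finBasis ℝ J).repr x i) p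
        = eval (fun i => (Module.finBasis ℝ J).repr x i) q) : p = q := by
  -- The Gram determinant vanishes exactly off the elements of maximal degree, so this product
  -- vanishes everywhere; it can be cancelled in the polynomial ring.
  have h0 : (p - q) * (gramMatrix Φ).det = 0 := by
    refine MvPolynomial.funext fun u => ?_
    obtain ⟨x, rfl⟩ : ∃ x : J, (fun i => (Module.finBasis ℝ J).repr x i) = u :=
      ⟨(Module.finBasis ℝ J).equivFun.symm u, (Module.finBasis ℝ J).equivFun.apply_symm_apply u⟩
    by_cases hx : jdegree x = jrank J
    · rw [_root_.map_mul, map_sub, hpq x hx, sub_self, zero_mul, map_zero]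
    · have := mt (hΦ.eval_gramMatrix_det_ne_zero_iff hinj x).1 hx
      rw [_root_.map_mul, not_not.1 this, mul_zero, map_zero]
  exact sub_eq_zero.1 ((mul_eq_zero.1 h0).resolve_right (hΦ.gramMatrix_det_ne_zero hinj))

theorem IsRepresentation.jrank_pos [Nontrivial E] (hΦ : IsRepresentation Φ)
    (hinj : Function.Injective Φ) : 0 < jrank J := by
  classical
  obtain ⟨e, l, h⟩ := hΦ.exists_eigenbasis (0 : J)
  refine lt_of_lt_of_le ?_ (jdegree_le_jrank (0 : J))
  rw [jdegree_eq_card hΦ hinj (e := e.toBasis) (l := l) (by simpa using h), Finset.card_pos]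
  exact ⟨l ⟨0, Module.finrank_pos⟩, Finset.mem_image_of_mem l (Finset.mem_univ _)⟩

/-- The numerator, by Cramer's rule, of the constant coefficient of the minimal polynomial. -/
def detNumerator (Φ : J →ₗ[ℝ] Module.End ℝ E) (hr : 0 < jrank J) :
    MvPolynomial (Fin (Module.finrank ℝ J)) ℝ :=
  (-1) ^ jrank J * (gramMatrix Φ).adjugate.mulVec
    (fun i => -(genericMatrix Φ ^ ((i : ℕ) + jrank J)).trace) ⟨0, hr⟩

theorem IsRepresentation.eval_detNumerator (hΦ : IsRepresentation Φ)
    (hinj : Function.Injective Φ) (hr : 0 < jrank J) (h : ∀ i, Φ x (e i) = l i • e i)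
    (hx : jdegree x = jrank J) :
    eval (fun i => (Module.finBasis ℝ J).repr x i) (detNumerator Φ hr)
      = eval (fun i => (Module.finBasis ℝ J).repr x i) (gramMatrix Φ).det
        * ∏ a ∈ Finset.univ.image l, a := by
  classical
  have h' : ∀ i, Φ x (e.toBasis i) = l i • e.toBasis i := by simpa using h
  have hf := isJMinpoly_prod hΦ hinj h'
  have hprod := hf.neg_one_pow_mul_coeff_zero hΦ hinj h'
  set f := ∏ a ∈ Finset.univ.image l, (Polynomial.X - Polynomial.C a) with hfdef
  obtain ⟨hm, hd, h0⟩ := hf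
  rw [← jaeval_apply, jaeval_eq_zero_iff hΦ hinj h'] at h0
  rw [hx] at hd hprod
  have hG : (powerGram l (jrank J)).mulVec (fun j => f.coeff j)
      = fun i : Fin (jrank J) => -∑ k, l k ^ ((i : ℕ) + jrank J) := by
    rw [← hd]
    ext i
    exact powerGram_mulVec_coeff hm h0 i
  rw [detNumerator, _root_.map_mul, map_pow, map_neg, _root_.map_one, RingHom.map_mulVec]
  have h2 : (gramMatrix Φ).adjugate.map (eval fun i => (Module.finBasis ℝ J).repr x i)
      = (powerGram l (jrank J)).adjugate := by
    rw [← RingHom.mapMatrix_apply, RingHom.map_adjugate, RingHom.mapMatrix_apply,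
      gramMatrix_map_eval h]
  have h3 : (eval fun i => (Module.finBasis ℝ J).repr x i) ∘
        (fun i : Fin (jrank J) => -(genericMatrix Φ ^ ((i : ℕ) + jrank J)).trace)
      = (powerGram l (jrank J)).mulVec (fun j => f.coeff j) := by
    rw [hG]
    ext i
    simp only [Function.comp_apply, map_neg, eval_trace_genericMatrix_pow h]
  rw [h2, h3, Matrix.mulVec_mulVec, Matrix.adjugate_mul, Matrix.smul_mulVec, Matrix.one_mulVec,
    eval_gramMatrix_det h, Pi.smul_apply, smul_eq_mul, ← hprod]
  ring

variable [IsSimpleRing J] [Nontrivial E]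

theorem IsRepresentation.exists_multiplicity (hΦ : IsRepresentation Φ)
    (hinj : Function.Injective Φ) : ∃ k : ℕ, 0 < k ∧ k * jrank J = Module.finrank ℝ E := by
  obtain ⟨x, hx⟩ := exists_jdegree_eq_jrank J
  obtain ⟨e, l, h⟩ := hΦ.exists_eigenbasis x
  have := hΦ.card_fiber_mul_jrank hinj h hx ⟨0, Module.finrank_pos⟩
  exact ⟨_, Finset.card_pos.2 ⟨⟨0, Module.finrank_pos⟩, by simp⟩, this⟩

/-- Cramer's rule gives only a quotient of polynomials, with the Gram determinant as denominator.
Its k-th power is the polynomial det Φ, so the quotient is itself a polynomial because the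
polynomial ring is integrally closed. -/
theorem IsRepresentation.exists_isDetPoly (hΦ : IsRepresentation Φ)
    (hinj : Function.Injective Φ) :
    ∃ d : MvPolynomial (Fin (Module.finrank ℝ J)) ℝ, IsDetPoly J d := by
  have hr := hΦ.jrank_pos hinj
  obtain ⟨k, hk0, hk⟩ := hΦ.exists_multiplicity hinj
  have hpow : detNumerator Φ hr ^ k = (gramMatrix Φ).det ^ k * repDetPoly Φ := by
    refine hΦ.eq_of_eval_eq hinj fun x hx => ?_
    obtain ⟨e, l, h⟩ := hΦ.exists_eigenbasis x
    rw [_root_.map_mul, map_pow, map_pow, hΦ.eval_detNumerator hinj hr h hx, eval_repDetPoly,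
      hΦ.det_eq_prod_pow hinj h hx hk hr, mul_pow]
  obtain ⟨d, hd⟩ := (IsIntegrallyClosed.pow_dvd_pow_iff hk0.ne').1 ⟨_, hpow⟩
  refine ⟨d, fun x hx f hf => ?_⟩
  obtain ⟨e, l, h⟩ := hΦ.exists_eigenbasis x
  have h1 := hΦ.eval_detNumerator hinj hr h hx
  rw [hd, _root_.map_mul] at h1
  rw [mul_left_cancel₀ ((hΦ.eval_gramMatrix_det_ne_zero_iff hinj x).2 hx) h1, ← hx]
  exact (hf.neg_one_pow_mul_coeff_zero hΦ hinj (e := e.toBasis) (l := l) (by simpa using h)).symm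

theorem IsRepresentation.jdet_eq_prod (hΦ : IsRepresentation Φ) (hinj : Function.Injective Φ)
    (h : ∀ i, Φ x (e i) = l i • e i) (hx : jdegree x = jrank J) :
    jdet x = ∏ a ∈ Finset.univ.image l, a := by
  classical
  have h' : ∀ i, Φ x (e.toBasis i) = l i • e.toBasis i := by simpa using h
  have hex := hΦ.exists_isDetPoly hinj
  have hd : IsDetPoly J (detPoly J) := by
    rw [detPoly, dif_pos hex]
    exact hex.choose_spec
  rw [jdet, hd x hx _ (isJMinpoly_prod hΦ hinj h'), ← hx]
  exact (isJMinpoly_prod hΦ hinj h').neg_one_pow_mul_coeff_zero hΦ hinj h'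

/-- On elements of maximal degree both sides are the k-th power of the product of the distinct
eigenvalues. Having this as an identity of polynomials is what allows passage to complex points. -/
theorem IsRepresentation.detPoly_pow (hΦ : IsRepresentation Φ) (hinj : Function.Injective Φ)
    {k : ℕ} (hk : k * jrank J = Module.finrank ℝ E) : detPoly J ^ k = repDetPoly Φ := by
  refine hΦ.eq_of_eval_eq hinj fun x hx => ?_
  obtain ⟨e, l, h⟩ := hΦ.exists_eigenbasis x
  have := hΦ.jdet_eq_prod hinj h hx
  rw [jdet] at this
  rw [map_pow, this, eval_repDetPoly, hΦ.det_eq_prod_pow hinj h hx hk (hΦ.jrank_pos hinj)]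

theorem IsRepresentation.jdet_pow (hΦ : IsRepresentation Φ) (hinj : Function.Injective Φ)
    {k : ℕ} (hk : k * jrank J = Module.finrank ℝ E) (x : J) :
    jdet x ^ k = LinearMap.det (Φ x) := by
  rw [jdet, ← map_pow, hΦ.detPoly_pow hinj hk, eval_repDetPoly]

end GenericMatrix

/-! ### The cone -/

section Cone

variable {J : Type*} [NonAssocCommRing J] [Module ℝ J]
  {E : Type*} [NormedAddCommGroup E] [InnerProductSpace ℝ E]
  {Φ : J →ₗ[ℝ] Module.End ℝ E}

theorem IsRepresentation.exists_sqrt_of_mem_cone (hΦ : IsRepresentation Φ) {y : J}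
    (hy : y ∈ cone J) : ∃ W V : Module.End ℝ E, Φ y = W * W ∧ W * V = 1 ∧ V * W = 1 ∧
      W.IsSymmetric := by
  obtain ⟨x, w, hw, rfl⟩ := hy
  exact ⟨Φ x, Φ w, hΦ.map_sq x, hw.map_mul_eq_one hΦ.isJordanHom,
    hw.map_mul_eq_one' hΦ.isJordanHom, hΦ.symm x⟩

theorem IsRepresentation.inner_pos_of_mem_cone (hΦ : IsRepresentation Φ) {y : J}
    (hy : y ∈ cone J) {ξ : E} (hξ : ξ ≠ 0) : 0 < inner ℝ (Φ y ξ) ξ := by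
  obtain ⟨W, V, hW, -, hVW, hs⟩ := hΦ.exists_sqrt_of_mem_cone hy
  rw [hW, Module.End.mul_apply, hs, real_inner_self_eq_norm_sq]
  refine pow_pos (norm_pos_iff.2 fun h0 => hξ ?_) 2
  have := LinearMap.congr_fun hVW ξ
  rwa [Module.End.mul_apply, h0, map_zero, Module.End.one_apply, eq_comm] at this

variable [FiniteDimensional ℝ E]

omit [FiniteDimensional ℝ E] in
theorem IsRepresentation.det_pos_of_mem_cone (hΦ : IsRepresentation Φ) {y : J}
    (hy : y ∈ cone J) : 0 < LinearMap.det (Φ y) := by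
  obtain ⟨W, V, hW, hWV, -, -⟩ := hΦ.exists_sqrt_of_mem_cone hy
  rw [hW, _root_.map_mul]
  refine mul_self_pos.2 fun h => ?_
  have := congr_arg LinearMap.det hWV
  rw [_root_.map_mul, h, zero_mul, _root_.map_one] at this
  exact zero_ne_one this

/-- The square root of y is found inside J, as the polynomial in y that interpolates the real square
root at the eigenvalues. The description by positivity is what makes the cone convex. -/
theorem IsRepresentation.mem_cone_iff (hΦ : IsRepresentation Φ) (hinj : Function.Injective Φ)
    {y : J} : y ∈ cone J ↔ ∀ ξ : E, ξ ≠ 0 → 0 < inner ℝ (Φ y ξ) ξ := by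
  classical
  refine ⟨fun hy ξ hξ => hΦ.inner_pos_of_mem_cone hy hξ, fun hpos => ?_⟩
  obtain ⟨e, l, h⟩ := hΦ.exists_eigenbasis y
  have hl : ∀ i, 0 < l i := by
    intro i
    have := hpos (e i) (e.orthonormal.ne_zero i)
    rwa [h, inner_smul_left, real_inner_self_eq_norm_sq, e.norm_eq_one, one_pow, mul_one] at this
  set x := jaeval ℝ y (Lagrange.interpolate (Finset.univ.image l) id Real.sqrt)
  have hx : ∀ i, Φ x (e i) = Real.sqrt (l i) • e i := by
    intro i
    rw [hΦ.isJordanHom.map_jaeval, aeval_apply_of_eigen (h i)]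
    have := Lagrange.eval_interpolate_at_node (s := Finset.univ.image l) (v := id)
      Real.sqrt (Set.injOn_id _) (Finset.mem_image_of_mem l (Finset.mem_univ i))
    simp only [id] at this
    rw [this]
  have hxy : y = x * x := by
    apply hinj
    refine e.toBasis.ext fun i => ?_
    rw [hΦ.map_sq, Module.End.mul_apply, e.coe_toBasis, hx, map_smul, hx, h, smul_smul,
      Real.mul_self_sqrt (hl i).le]
  have hdet : LinearMap.det (Φ x) ≠ 0 := by
    intro h0
    obtain ⟨v, hv, hv0⟩ := Submodule.exists_mem_ne_zero_of_ne_bot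
      (LinearMap.bot_lt_ker_of_det_eq_zero h0).ne'
    have := hpos v hv0
    rw [hxy, hΦ.map_sq, Module.End.mul_apply, LinearMap.mem_ker.1 hv, map_zero,
      inner_zero_left] at this
    exact lt_irrefl _ this
  obtain ⟨w, hw⟩ := hΦ.isJordanHom.exists_isJInverse hinj hdet
  exact ⟨x, w, hw, hxy⟩

theorem IsRepresentation.convex_cone (hΦ : IsRepresentation Φ) (hinj : Function.Injective Φ) :
    Convex ℝ (cone J) := by
  intro y hy z hz a b ha hb hab
  rw [hΦ.mem_cone_iff hinj] at *
  intro ξ hξ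
  rw [map_add, map_smul, map_smul, LinearMap.add_apply, LinearMap.smul_apply,
    LinearMap.smul_apply, inner_add_left, real_inner_smul_left, real_inner_smul_left]
  rcases ha.eq_or_lt with rfl | ha
  · rw [zero_add] at hab
    rw [hab]
    simpa using hz ξ hξ
  · have h1 := mul_pos ha (hy ξ hξ)
    have h2 := mul_nonneg hb (hz ξ hξ).le
    linarith

theorem IsRepresentation.one_mem_cone (hΦ : IsRepresentation Φ) (hinj : Function.Injective Φ) :
    (1 : J) ∈ cone J := by
  rw [hΦ.mem_cone_iff hinj]
  intro ξ hξ
  rw [hΦ.map_one, Module.End.one_apply]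
  exact real_inner_self_pos.2 hξ

variable [Module.Finite ℝ J]

/-- Adding a large multiple of e makes all eigenvalues positive without changing how many are
distinct. -/
theorem IsRepresentation.exists_regular_mem_cone (hΦ : IsRepresentation Φ)
    (hinj : Function.Injective Φ) :
    ∃ (x : J) (e : OrthonormalBasis (Fin (Module.finrank ℝ E)) ℝ E)
      (l : Fin (Module.finrank ℝ E) → ℝ), x ∈ cone J ∧ jdegree x = jrank J ∧
      (∀ i, Φ x (e i) = l i • e i) ∧ ∀ i, 0 < l i := by
  classical
  obtain ⟨x, hx⟩ := exists_jdegree_eq_jrank J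
  obtain ⟨e, l, h⟩ := hΦ.exists_eigenbasis x
  obtain ⟨t, ht⟩ : ∃ t : ℝ, t = 1 + ∑ i, |l i| := ⟨_, rfl⟩
  have hpos : ∀ i, 0 < l i + t := by
    intro i
    have h1 := Finset.single_le_sum (f := fun i => |l i|) (fun i _ => abs_nonneg _)
      (Finset.mem_univ i)
    have h2 := neg_abs_le (l i)
    linarith
  have hl : ∀ i, Φ (x + t • 1) (e i) = (l i + t) • e i := by
    intro i
    rw [map_add, map_smul, hΦ.map_one, LinearMap.add_apply, h, LinearMap.smul_apply,
      Module.End.one_apply, add_smul]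
  refine ⟨x + t • 1, e, fun i => l i + t, ?_, ?_, hl, hpos⟩
  · rw [hΦ.mem_cone_iff hinj]
    intro ξ hξ
    have hexp : inner ℝ (Φ (x + t • 1) ξ) ξ = ∑ i, (l i + t) * (e.repr ξ i) ^ 2 := by
      conv_lhs => rw [← e.sum_repr ξ]
      rw [map_sum, sum_inner]
      refine Finset.sum_congr rfl fun i _ => ?_
      rw [map_smul, hl, e.sum_repr, real_inner_smul_left, real_inner_smul_left,
        ← e.repr_apply_apply]
      ring
    rw [hexp]
    obtain ⟨i, hi⟩ : ∃ i, e.repr ξ i ≠ 0 := by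
      by_contra hn
      push Not at hn
      apply hξ
      rw [← e.sum_repr ξ]
      simp [hn]
    exact Finset.sum_pos' (fun i _ => mul_nonneg (hpos i).le (sq_nonneg _))
      ⟨i, Finset.mem_univ i, mul_pos (hpos i) (by positivity)⟩
  · rw [← hx, jdegree_eq_card hΦ hinj (x := x) (e := e.toBasis) (l := l) (by simpa using h),
      jdegree_eq_card hΦ hinj (e := e.toBasis) (l := fun i => l i + t)
        (fun i => by rw [e.coe_toBasis]; exact hl i)]
    have : (Finset.univ.image fun i => l i + t) = (Finset.univ.image l).image (· + t) := by
      rw [Finset.image_image]; rfl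
    rw [this, Finset.card_image_of_injective _ (add_left_injective t)]

/-- Positivity of det Φ(y) = (det y)^k only shows det y ≠ 0, as k may be even. The sign is carried
along a segment in the cone from an element of maximal degree, where det is a product of positive
eigenvalues. -/
theorem IsRepresentation.jdet_pos [IsSimpleRing J] [Nontrivial E] (hΦ : IsRepresentation Φ)
    (hinj : Function.Injective Φ) {y : J} (hy : y ∈ cone J) : 0 < jdet y := by
  classical
  obtain ⟨k, hk0, hk⟩ := hΦ.exists_multiplicity hinj
  have hne : ∀ y ∈ cone J, jdet y ≠ 0 := by
    intro y hy h0
    have h1 := hΦ.jdet_pow hinj hk y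
    rw [h0, zero_pow hk0.ne'] at h1
    exact (hΦ.det_pos_of_mem_cone hy).ne h1
  obtain ⟨x, e, l, hxc, hx, h, hl⟩ := hΦ.exists_regular_mem_cone hinj
  have hxpos : 0 < jdet x := by
    rw [hΦ.jdet_eq_prod hinj h hx]
    refine Finset.prod_pos fun a ha => ?_
    obtain ⟨i, -, rfl⟩ := Finset.mem_image.1 ha
    exact hl i
  by_contra hle
  have hlt : jdet y < 0 := lt_of_le_of_ne (not_lt.1 hle) (hne y hy)
  have hcont : Continuous fun t : ℝ => jdet ((1 - t) • y + t • x) := by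
    have : (fun t : ℝ => jdet ((1 - t) • y + t • x)) = fun t : ℝ => MvPolynomial.eval
        (fun i => (1 - t) * (Module.finBasis ℝ J).repr y i + t * (Module.finBasis ℝ J).repr x i)
        (detPoly J) := by
      ext t
      simp [jdet]
    rw [this]
    exact (MvPolynomial.continuous_eval (detPoly J)).comp (by fun_prop)
  obtain ⟨t, ht, ht0⟩ := intermediate_value_Icc (zero_le_one' ℝ) hcont.continuousOn
    (show (0 : ℝ) ∈ Set.Icc _ _ by simp [hlt.le, hxpos.le])
  exact hne _ (hΦ.convex_cone hinj hy hxc (sub_nonneg.2 ht.2) ht.1 (by ring)) ht0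

end Cone

/-! ### Complexification -/

section Complexification

theorem exists_tmul_add_tmul {V : Type*} [AddCommGroup V] [Module ℝ V] (z : ℂ ⊗[ℝ] V) :
    ∃ x y : V, z = (1 : ℂ) ⊗ₜ[ℝ] x + Complex.I ⊗ₜ[ℝ] y := by
  induction z with
  | zero => exact ⟨0, 0, by simp⟩
  | tmul a v =>
    refine ⟨a.re • v, a.im • v, ?_⟩
    rw [← TensorProduct.smul_tmul, ← TensorProduct.smul_tmul, ← TensorProduct.add_tmul]
    congr 1
    apply Complex.ext <;> simp
  | add z w hz hw =>
    obtain ⟨x, y, rfl⟩ := hz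
    obtain ⟨x', y', rfl⟩ := hw
    exact ⟨x + x', y + y', by simp only [TensorProduct.tmul_add]; abel⟩

theorem tmul_add_tmul_inj {V : Type*} [AddCommGroup V] [Module ℝ V] {x y x' y' : V}
    (h : (1 : ℂ) ⊗ₜ[ℝ] x + Complex.I ⊗ₜ[ℝ] y = (1 : ℂ) ⊗ₜ[ℝ] x' + Complex.I ⊗ₜ[ℝ] y') :
    x = x' ∧ y = y' := by
  constructor
  · have := congr_arg (fun z => TensorProduct.lid ℝ V (Complex.reLm.rTensor V z)) h
    simpa using this
  · have := congr_arg (fun z => TensorProduct.lid ℝ V (Complex.imLm.rTensor V z)) h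
    simpa using this

variable {J : Type*} [NonAssocCommRing J] [Module ℝ J]
  {E : Type*} [NormedAddCommGroup E] [InnerProductSpace ℝ E]
  {Φ : J →ₗ[ℝ] Module.End ℝ E}

theorem complexRep_tmul (a : ℂ) (x : J) :
    complexRep Φ (a ⊗ₜ[ℝ] x) = a • LinearMap.baseChange ℂ (Φ x) := by
  simp [complexRep]

theorem complexRep_apply (x y : J) (ξ : E) :
    complexRep Φ ((1 : ℂ) ⊗ₜ[ℝ] x + Complex.I ⊗ₜ[ℝ] y) ((1 : ℂ) ⊗ₜ[ℝ] ξ)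
      = (1 : ℂ) ⊗ₜ[ℝ] Φ x ξ + Complex.I ⊗ₜ[ℝ] Φ y ξ := by
  simp [complexRep_tmul, TensorProduct.smul_tmul']

theorem complexRep_apply' (x y : J) (ξ η : E) :
    complexRep Φ ((1 : ℂ) ⊗ₜ[ℝ] x + Complex.I ⊗ₜ[ℝ] y)
        ((1 : ℂ) ⊗ₜ[ℝ] ξ + Complex.I ⊗ₜ[ℝ] η)
      = (1 : ℂ) ⊗ₜ[ℝ] (Φ x ξ - Φ y η) + Complex.I ⊗ₜ[ℝ] (Φ x η + Φ y ξ) := by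
  simp only [complexRep_tmul, map_add, LinearMap.add_apply, LinearMap.smul_apply, one_smul,
    LinearMap.baseChange_tmul, TensorProduct.smul_tmul', smul_eq_mul, Complex.I_mul_I, mul_one,
    TensorProduct.tmul_add, TensorProduct.tmul_sub, TensorProduct.neg_tmul]
  abel

theorem complexRep_injective (hinj : Function.Injective Φ) :
    Function.Injective (complexRep Φ) := by
  rw [injective_iff_map_eq_zero]
  intro z hz
  obtain ⟨x, y, rfl⟩ := exists_tmul_add_tmul z
  have h : ∀ ξ, Φ x ξ = 0 ∧ Φ y ξ = 0 := by
    intro ξ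
    have h1 := LinearMap.congr_fun hz ((1 : ℂ) ⊗ₜ[ℝ] ξ)
    rw [complexRep_apply, LinearMap.zero_apply] at h1
    exact tmul_add_tmul_inj (h1.trans (by simp))
  have hx : x = 0 := hinj (by ext ξ; simp [(h ξ).1])
  have hy : y = 0 := hinj (by ext ξ; simp [(h ξ).2])
  simp [hx, hy]

theorem IsRepresentation.isJordanHom_complexRep [SMulCommClass ℝ J J] [IsScalarTower ℝ J J]
    (hΦ : IsRepresentation Φ) :
    IsJordanHom (S := Module.End ℂ (ℂ ⊗[ℝ] E)) (complexRep Φ) where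
  map_one := by
    rw [Algebra.TensorProduct.one_def, complexRep_tmul, hΦ.map_one, one_smul]
    ext; simp
  map_mul z w := by
    induction z with
    | zero => simp
    | add z z' hz hz' =>
      rw [add_mul, map_add, map_add, hz, hz']
      simp only [mul_add, add_mul, smul_add]
      abel
    | tmul a x =>
      induction w with
      | zero => simp
      | add w w' hw hw' =>
        rw [mul_add, map_add, map_add, hw, hw']
        simp only [mul_add, add_mul, smul_add]
        abel
      | tmul b y =>
        rw [Algebra.TensorProduct.tmul_mul_tmul, complexRep_tmul, complexRep_tmul,
          complexRep_tmul, hΦ.map_mul]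
        refine TensorProduct.AlgebraTensorModule.ext fun c ξ => ?_
        simp only [LinearMap.smul_apply, LinearMap.add_apply, Module.End.mul_apply,
          LinearMap.baseChange_tmul, TensorProduct.tmul_smul, TensorProduct.tmul_add,
          TensorProduct.smul_tmul', smul_eq_mul, smul_add]
        rw [mul_comm b (a * c), mul_right_comm, ← mul_assoc]
        congr 1
        all_goals
          congr 1
          rw [Complex.real_smul]
          push_cast
          ring

variable [FiniteDimensional ℝ E]

/-- If ξ + iη is in the kernel, computing ⟨Φ(x)ξ, η⟩ from the real and from the imaginary part gives
⟨Φ(y)ξ,ξ⟩ + ⟨Φ(y)η,η⟩ = 0, so both vectors vanish. -/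
theorem IsRepresentation.det_complexRep_ne_zero (hΦ : IsRepresentation Φ)
    {z : ℂ ⊗[ℝ] J} (hz : z ∈ tube J) : LinearMap.det (complexRep Φ z) ≠ 0 := by
  intro h0
  obtain ⟨v, hv, hv0⟩ := Submodule.exists_mem_ne_zero_of_ne_bot
      (LinearMap.bot_lt_ker_of_det_eq_zero h0).ne'
  obtain ⟨x, y, hy, rfl⟩ := hz
  obtain ⟨ξ, η, rfl⟩ := exists_tmul_add_tmul v
  rw [LinearMap.mem_ker, complexRep_apply'] at hv
  obtain ⟨h1, h2⟩ := tmul_add_tmul_inj (hv.trans (by simp :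
    _ = (1 : ℂ) ⊗ₜ[ℝ] (0 : E) + Complex.I ⊗ₜ[ℝ] (0 : E)))
  have h3 : inner ℝ (Φ x ξ - Φ y η) η = 0 := by rw [h1, inner_zero_left]
  have h4 : inner ℝ (Φ x η + Φ y ξ) ξ = 0 := by rw [h2, inner_zero_left]
  rw [inner_sub_left] at h3
  rw [inner_add_left, hΦ.symm, real_inner_comm] at h4
  have hnn : ∀ ζ, 0 ≤ inner ℝ (Φ y ζ) ζ := by
    intro ζ
    by_cases hζ : ζ = 0
    · simp [hζ]
    · exact (hΦ.inner_pos_of_mem_cone hy hζ).le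
  have e1 := hnn ξ
  have e2 := hnn η
  have h5 : ξ = 0 := by
    by_contra hne
    have := hΦ.inner_pos_of_mem_cone hy hne
    linarith
  have h6 : η = 0 := by
    by_contra hne
    have := hΦ.inner_pos_of_mem_cone hy hne
    linarith
  exact hv0 (by simp [h5, h6])

theorem IsRepresentation.isJInverse_of_mem_tube [SMulCommClass ℝ J J] [IsScalarTower ℝ J J]
    (hΦ : IsRepresentation Φ) (hinj : Function.Injective Φ)
    {z : ℂ ⊗[ℝ] J} (hz : z ∈ tube J) : IsJInverse ℂ z (jinv ℂ z) :=
  jinv_spec (hΦ.isJordanHom_complexRep.exists_isJInverse (complexRep_injective hinj)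
    (hΦ.det_complexRep_ne_zero hz))

/-- The real and imaginary parts of the identity `Φ(z) Φ(-z⁻¹) = -1`. -/
theorem IsRepresentation.exists_neg_jinv [SMulCommClass ℝ J J] [IsScalarTower ℝ J J]
    (hΦ : IsRepresentation Φ) (hinj : Function.Injective Φ) {x y : J} (hy : y ∈ cone J) :
    ∃ x' y' : J, -jinv ℂ ((1 : ℂ) ⊗ₜ[ℝ] x + Complex.I ⊗ₜ[ℝ] y)
        = (1 : ℂ) ⊗ₜ[ℝ] x' + Complex.I ⊗ₜ[ℝ] y' ∧
      (∀ η, Φ y (Φ y' η) - Φ x (Φ x' η) = η) ∧ ∀ η, Φ x (Φ y' η) + Φ y (Φ x' η) = 0 := by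
  have hz : (1 : ℂ) ⊗ₜ[ℝ] x + Complex.I ⊗ₜ[ℝ] y ∈ tube J := ⟨x, y, hy, rfl⟩
  have h1 := (hΦ.isJInverse_of_mem_tube hinj hz).map_mul_eq_one hΦ.isJordanHom_complexRep
  obtain ⟨x', y', h⟩ := exists_tmul_add_tmul
    (-jinv ℂ ((1 : ℂ) ⊗ₜ[ℝ] x + Complex.I ⊗ₜ[ℝ] y))
  have key : ∀ η, Φ x (Φ x' η) - Φ y (Φ y' η) = -η ∧ Φ x (Φ y' η) + Φ y (Φ x' η) = 0 := by
    intro η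
    have h2 := LinearMap.congr_fun h1 ((1 : ℂ) ⊗ₜ[ℝ] η)
    rw [Module.End.mul_apply, Module.End.one_apply, ← neg_neg (jinv ℂ _), h, map_neg, LinearMap.neg_apply, map_neg,
      complexRep_apply, complexRep_apply', neg_eq_iff_eq_neg] at h2
    exact tmul_add_tmul_inj (h2.trans (by simp [TensorProduct.tmul_neg]))
  refine ⟨x', y', h, fun η => ?_, fun η => (key η).2⟩
  rw [← neg_sub, (key η).1, neg_neg]

theorem IsRepresentation.cdet_pow [IsSimpleRing J] [Nontrivial E] [Module.Finite ℝ J]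
    (hΦ : IsRepresentation Φ) (hinj : Function.Injective Φ)
    {k : ℕ} (hk : k * jrank J = Module.finrank ℝ E) (z : ℂ ⊗[ℝ] J) :
    cdet z ^ k = LinearMap.det (complexRep Φ z) := by
  rw [cdet, polyEval, ← map_pow, ← map_pow, hΦ.detPoly_pow hinj hk, repDetPoly, RingHom.map_det,
    RingHom.map_det, ← LinearMap.det_toMatrix ((stdOrthonormalBasis ℝ E).toBasis.baseChange ℂ)]
  congr 1
  ext a b
  conv_rhs => rw [← ((Module.finBasis ℝ J).baseChange ℂ).sum_repr z]
  simp only [RingHom.mapMatrix_apply, Matrix.map_apply, genericMatrix, map_sum,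
    _root_.map_mul, MvPolynomial.map_X, MvPolynomial.map_C, MvPolynomial.eval_X,
    MvPolynomial.eval_C, map_smul, Matrix.sum_apply, Matrix.smul_apply, smul_eq_mul]
  refine Finset.sum_congr rfl fun i _ => ?_
  congr 1
  rw [Module.Basis.baseChange_apply, complexRep_tmul, one_smul]
  refine Eq.trans ?_ (LinearMap.toMatrix_apply _ _ _ a b).symm
  rw [Module.Basis.baseChange_apply, LinearMap.baseChange_tmul, Module.Basis.baseChange_repr_tmul]
  simp [LinearMap.toMatrix_apply]

end Complexification

/-! ### Functionals of Gaussian type on polynomials -/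

section GaussianFunctional

open MvPolynomial

variable {σ : Type*} [Fintype σ]

/-- The constant coefficient operator `∑ g i j ∂ᵢ ∂ⱼ`. -/
def quadOp (g : σ → σ → ℂ) (q : MvPolynomial σ ℂ) : MvPolynomial σ ℂ :=
  ∑ i, ∑ j, g i j • pderiv j (pderiv i q)

theorem quadOp_sum (g : σ → σ → ℂ) {α : Type*} (s : Finset α) (q : α → MvPolynomial σ ℂ) :
    quadOp g (∑ a ∈ s, q a) = ∑ a ∈ s, quadOp g (q a) := by
  simp only [quadOp, map_sum, Finset.smul_sum]
  rw [Finset.sum_comm (s := s)]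
  exact Finset.sum_congr rfl fun i _ => Finset.sum_comm

theorem quadOp_isHomogeneous (g : σ → σ → ℂ) {q : MvPolynomial σ ℂ} {n : ℕ}
    (hq : q.IsHomogeneous n) : (quadOp g q).IsHomogeneous (n - 1 - 1) := by
  refine IsHomogeneous.sum _ _ _ fun i _ => IsHomogeneous.sum _ _ _ fun j _ => ?_
  exact (homogeneousSubmodule σ ℂ (n - 1 - 1)).smul_mem _ (hq.pderiv.pderiv)

theorem quadOp_eq_zero_of_lt_two (g : σ → σ → ℂ) {q : MvPolynomial σ ℂ} {n : ℕ}
    (hq : q.IsHomogeneous n) (hn : n < 2) : quadOp g q = 0 := by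
  refine Finset.sum_eq_zero fun i _ => Finset.sum_eq_zero fun j _ => ?_
  have h1 : (pderiv i q).IsHomogeneous 0 := by
    have := hq.pderiv (i := i)
    rwa [show n - 1 = 0 by omega] at this
  rw [← totalDegree_zero_iff_isHomogeneous, totalDegree_eq_zero_iff_eq_C] at h1
  rw [h1, pderiv_C, smul_zero]

theorem quadOp_homogeneousComponent (g : σ → σ → ℂ) {q : MvPolynomial σ ℂ}
    (hq : quadOp g q = 0) (n : ℕ) : quadOp g (homogeneousComponent n q) = 0 := by
  -- The truncated n - 1 - 1 sends degrees 0, 1 and 2 to the same place. Degrees below 2 are killed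
  -- by the operator and are set aside, so that the remaining ones land in distinct degrees.
  by_cases hn : n < 2
  · exact quadOp_eq_zero_of_lt_two g (homogeneousComponent_isHomogeneous n q) hn
  have h1 := congr_arg (homogeneousComponent (n - 1 - 1)) hq
  rw [← sum_homogeneousComponent q, quadOp_sum, map_sum, map_zero] at h1
  by_cases hmem : n ∈ Finset.range (q.totalDegree + 1)
  · rw [Finset.sum_eq_single n] at h1
    · rwa [homogeneousComponent_of_mem
        (quadOp_isHomogeneous g (homogeneousComponent_isHomogeneous n q)), if_pos rfl] at h1
    · intro m _ hmn
      by_cases hm : m < 2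
      · rw [quadOp_eq_zero_of_lt_two g (homogeneousComponent_isHomogeneous m q) hm, map_zero]
      · rw [homogeneousComponent_of_mem
          (quadOp_isHomogeneous g (homogeneousComponent_isHomogeneous m q)), if_neg (by omega)]
    · intro h; exact absurd hmem h
  · rw [homogeneousComponent_eq_zero n q (by simpa [Nat.lt_succ_iff] using hmem)]
    simp [quadOp]

/-- A functional for which multiplication by `X i` is dual to `∑ g i j ∂ⱼ` evaluates, up to a
constant, polynomials annihilated by `∑ g i j ∂ᵢ ∂ⱼ` at the origin. -/
theorem functional_eq_coeff_zero (I : MvPolynomial σ ℂ →ₗ[ℂ] ℂ) {g : σ → σ → ℂ}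
    (hI : ∀ i q, I (X i * q) = ∑ j, g i j * I (pderiv j q)) {q : MvPolynomial σ ℂ}
    (hq : quadOp g q = 0) : I q = I 1 * coeff 0 q := by
  have hn : ∀ n, n ≠ 0 → I (homogeneousComponent n q) = 0 := by
    intro n hn
    -- Euler's identity: n I(q_n) = ∑ I(X_i ∂_i q_n) = ∑ g_ij I(∂_j ∂_i q_n) = 0.
    have h1 := (homogeneousComponent_isHomogeneous n q).sum_X_mul_pderiv
    have h2 := congr_arg I (quadOp_homogeneousComponent g hq n)
    have h3 := congr_arg I h1
    rw [map_sum] at h3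
    simp only [hI] at h3
    simp only [quadOp, map_sum, map_smul, smul_eq_mul, map_zero] at h2
    rw [h2, map_nsmul, eq_comm, nsmul_eq_mul, mul_eq_zero] at h3
    exact h3.resolve_left (Nat.cast_ne_zero.2 hn)
  conv_lhs => rw [← sum_homogeneousComponent q]
  rw [map_sum, Finset.sum_eq_single 0 (fun n _ h => hn n h) (by simp), homogeneousComponent_zero,
    ← mul_one (C _), ← smul_eq_C_mul, map_smul, smul_eq_mul, mul_comm]

/-- Translation of polynomials. -/
def translate (m : σ → ℂ) : MvPolynomial σ ℂ →ₐ[ℂ] MvPolynomial σ ℂ :=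
  aeval fun i => X i + C (m i)

omit [Fintype σ] in
theorem pderiv_translate (m : σ → ℂ) (i : σ) (q : MvPolynomial σ ℂ) :
    pderiv i (translate m q) = translate m (pderiv i q) := by
  classical
  induction q using MvPolynomial.induction_on with
  | C a => simp [translate]
  | add p q hp hq => simp only [map_add, hp, hq]
  | mul_X p j hp =>
    rw [map_mul, Derivation.leibniz, Derivation.leibniz, map_add, hp]
    have : pderiv i (translate m (X j)) = translate m (pderiv i (X j)) := by
      simp only [translate, aeval_X, map_add, pderiv_C, add_zero, pderiv_X, Pi.single_apply]
      split_ifs <;> simp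
    rw [this]
    simp only [smul_eq_mul, map_mul]

omit [Fintype σ] in
theorem translate_translate_neg (m : σ → ℂ) (q : MvPolynomial σ ℂ) :
    translate (-m) (translate m q) = q := by
  have : (translate (-m)).comp (translate m) = AlgHom.id ℂ _ := by
    refine algHom_ext fun i => ?_
    simp [translate]
  exact DFunLike.congr_fun this q

omit [Fintype σ] in
theorem eval_zero_translate (m : σ → ℂ) (q : MvPolynomial σ ℂ) :
    eval 0 (translate m q) = eval m q := by
  induction q using MvPolynomial.induction_on with
  | C a => simp [translate]
  | add p q hp hq => simp only [map_add, hp, hq]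
  | mul_X p j hp => rw [map_mul, map_mul, map_mul, hp]; simp [translate]

/-- Translations commute with constant coefficient operators, so moving m to the origin reduces this
to `functional_eq_coeff_zero`. -/
theorem functional_eq_eval (I : MvPolynomial σ ℂ →ₗ[ℂ] ℂ) {g : σ → σ → ℂ} {m : σ → ℂ}
    (hI : ∀ i q, I ((X i - C (m i)) * q) = ∑ j, g i j * I (pderiv j q)) {q : MvPolynomial σ ℂ}
    (hq : quadOp g q = 0) : I q = I 1 * eval m q := by
  have h := functional_eq_coeff_zero (I ∘ₗ (translate (-m)).toLinearMap) (g := g)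
    (q := translate m q) ?_ ?_
  · simp only [LinearMap.comp_apply, AlgHom.toLinearMap_apply, translate_translate_neg,
      map_one] at h
    rw [h, ← constantCoeff_eq, ← eval_zero, eval_zero_translate]
  · intro i p
    simp only [LinearMap.comp_apply, AlgHom.toLinearMap_apply, map_mul, ← pderiv_translate]
    rw [← hI]
    simp [translate, sub_eq_add_neg]
  · simp only [quadOp, pderiv_translate, ← map_smul, ← map_sum] at hq ⊢
    rw [hq, map_zero]

end GaussianFunctional

/-! ### Gaussian integrals with a complex symmetric matrix -/

section PolynomialFunctions

variable {E : Type*} [NormedAddCommGroup E] [InnerProductSpace ℝ E] [FiniteDimensional ℝ E]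
  {ι : Type*} [Fintype ι] (b : Module.Basis ι ℝ E)

/-- The coordinate function of a basis, as a complex valued continuous linear form. -/
def coordCLM (i : ι) : E →L[ℝ] ℂ :=
  Complex.ofRealCLM ∘L (b.coord i).toContinuousLinearMap

omit [Fintype ι] in
theorem coordCLM_apply (i : ι) (ξ : E) : coordCLM b i ξ = (b.repr ξ i : ℂ) := rfl

theorem hasFDerivAt_polyEvalReal (q : MvPolynomial ι ℂ) (ξ : E) :
    HasFDerivAt (polyEvalReal b q)
      (∑ i, polyEvalReal b (MvPolynomial.pderiv i q) ξ • coordCLM b i) ξ := by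
  classical
  induction q using MvPolynomial.induction_on with
  | C a =>
    have : polyEvalReal b (MvPolynomial.C a) = fun _ => a := by ext; simp [polyEvalReal]
    rw [this]
    refine (hasFDerivAt_const a ξ).congr_fderiv ?_
    ext v
    simp [polyEvalReal]
  | add p q hp hq =>
    have : polyEvalReal b (p + q) = fun ζ => polyEvalReal b p ζ + polyEvalReal b q ζ := by
      ext; simp [polyEvalReal]
    rw [this]
    refine (hp.add hq).congr_fderiv ?_
    rw [← Finset.sum_add_distrib]
    refine Finset.sum_congr rfl fun i _ => ?_
    rw [← add_smul]
    simp [polyEvalReal]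
  | mul_X p j hp =>
    have : polyEvalReal b (p * MvPolynomial.X j)
        = fun ζ => polyEvalReal b p ζ * coordCLM b j ζ := by
      ext; simp [polyEvalReal, coordCLM_apply]
    rw [this]
    refine (hp.mul (coordCLM b j).hasFDerivAt).congr_fderiv ?_
    have h1 : ∀ i, polyEvalReal b (MvPolynomial.pderiv i (p * MvPolynomial.X j)) ξ
        = polyEvalReal b p ξ * (if i = j then 1 else 0)
          + coordCLM b j ξ * polyEvalReal b (MvPolynomial.pderiv i p) ξ := by
      intro i
      simp only [polyEvalReal, Derivation.leibniz, map_add, smul_eq_mul, map_mul,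
        MvPolynomial.eval_X, MvPolynomial.pderiv_X, Pi.single_apply, coordCLM_apply, eq_comm]
      split_ifs <;> simp
    have h2 : ∀ i, polyEvalReal b (MvPolynomial.pderiv i (p * MvPolynomial.X j)) ξ • coordCLM b i
        = (if i = j then polyEvalReal b p ξ • coordCLM b j else 0)
          + coordCLM b j ξ • polyEvalReal b (MvPolynomial.pderiv i p) ξ • coordCLM b i := by
      intro i
      rw [h1]
      ext v
      split_ifs with hij
      · subst hij
        simp only [add_apply, smul_apply, smul_eq_mul]
        ring
      · simp only [add_apply, smul_apply, smul_eq_mul, zero_apply]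
        ring
    rw [Finset.sum_congr rfl fun i _ => h2 i, Finset.sum_add_distrib, ← Finset.smul_sum,
      Finset.sum_ite_eq' Finset.univ j, if_pos (Finset.mem_univ j)]

theorem continuous_polyEvalReal (q : MvPolynomial ι ℂ) : Continuous (polyEvalReal b q) :=
  continuous_iff_continuousAt.2 fun ξ => (hasFDerivAt_polyEvalReal b q ξ).continuousAt

omit [Fintype ι] in
theorem exists_norm_polyEvalReal_le (q : MvPolynomial ι ℂ) {ε : ℝ} (hε : 0 < ε) :
    ∃ C : ℝ, ∀ ξ, ‖polyEvalReal b q ξ‖ ≤ C * Real.exp (ε * ‖ξ‖ ^ 2) := by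
  induction q using MvPolynomial.induction_on generalizing ε with
  | C a =>
    refine ⟨‖a‖, fun ξ => ?_⟩
    have h1 : 1 ≤ Real.exp (ε * ‖ξ‖ ^ 2) := Real.one_le_exp (by positivity)
    simpa [polyEvalReal] using le_mul_of_one_le_right (norm_nonneg a) h1
  | add p q hp hq =>
    obtain ⟨C, hC⟩ := hp hε
    obtain ⟨C', hC'⟩ := hq hε
    refine ⟨C + C', fun ξ => ?_⟩
    have : polyEvalReal b (p + q) ξ = polyEvalReal b p ξ + polyEvalReal b q ξ := by
      simp [polyEvalReal]
    rw [this, add_mul]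
    exact (norm_add_le _ _).trans (add_le_add (hC ξ) (hC' ξ))
  | mul_X p j hp =>
    -- Half of the exponent bounds p, the other half absorbs the new coordinate.
    obtain ⟨C, hC⟩ := hp (half_pos hε)
    refine ⟨C * (‖coordCLM b j‖ * (1 + 2 / ε)), fun ξ => ?_⟩
    have : polyEvalReal b (p * MvPolynomial.X j) ξ = polyEvalReal b p ξ * coordCLM b j ξ := by
      simp [polyEvalReal, coordCLM_apply]
    rw [this, norm_mul]
    have h1 : ‖coordCLM b j ξ‖ ≤ ‖coordCLM b j‖ * (1 + 2 / ε) * Real.exp (ε / 2 * ‖ξ‖ ^ 2) := by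
      refine ((coordCLM b j).le_opNorm ξ).trans ?_
      rw [mul_assoc]
      refine mul_le_mul_of_nonneg_left ?_ (norm_nonneg _)
      have h2 : ‖ξ‖ ≤ 1 + ‖ξ‖ ^ 2 := by nlinarith [sq_nonneg (‖ξ‖ - 1), norm_nonneg ξ]
      have h3 : 1 ≤ Real.exp (ε / 2 * ‖ξ‖ ^ 2) := Real.one_le_exp (by positivity)
      have h4 : ε / 2 * ‖ξ‖ ^ 2 ≤ Real.exp (ε / 2 * ‖ξ‖ ^ 2) := by
        linarith [Real.add_one_le_exp (ε / 2 * ‖ξ‖ ^ 2)]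
      have h5 : ‖ξ‖ ^ 2 ≤ 2 / ε * Real.exp (ε / 2 * ‖ξ‖ ^ 2) := by
        calc ‖ξ‖ ^ 2 = 2 / ε * (ε / 2 * ‖ξ‖ ^ 2) := by field_simp
          _ ≤ _ := mul_le_mul_of_nonneg_left h4 (by positivity)
      rw [add_mul, one_mul]
      linarith
    have h6 : Real.exp (ε * ‖ξ‖ ^ 2)
        = Real.exp (ε / 2 * ‖ξ‖ ^ 2) * Real.exp (ε / 2 * ‖ξ‖ ^ 2) := by
      rw [← Real.exp_add]; congr 1; ring
    calc _ ≤ (C * Real.exp (ε / 2 * ‖ξ‖ ^ 2)) *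
          (‖coordCLM b j‖ * (1 + 2 / ε) * Real.exp (ε / 2 * ‖ξ‖ ^ 2)) :=
          mul_le_mul (hC ξ) h1 (norm_nonneg _) ((norm_nonneg _).trans (hC ξ))
      _ = _ := by rw [h6]; ring

end PolynomialFunctions

/-! ### Integrability and integration by parts. -/

section GaussianIntegral

variable {E : Type*} [NormedAddCommGroup E] [InnerProductSpace ℝ E]

/-- The function `exp(i⟨ξ,η⟩) exp((i/2)(⟨Tξ,ξ⟩ + i⟨Sξ,ξ⟩))`. -/
def gaussExp (S T : Module.End ℝ E) (η ξ : E) : ℂ :=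
  Complex.exp (Complex.I * ((inner ℝ ξ η : ℝ) : ℂ)) *
    Complex.exp (Complex.I / 2 *
      (((inner ℝ (T ξ) ξ : ℝ) : ℂ) + Complex.I * ((inner ℝ (S ξ) ξ : ℝ) : ℂ)))

variable {S T : Module.End ℝ E}

theorem norm_gaussExp (η ξ : E) :
    ‖gaussExp S T η ξ‖ = Real.exp (-(1 / 2) * inner ℝ (S ξ) ξ) := by
  rw [gaussExp, norm_mul, Complex.norm_exp, Complex.norm_exp, ← Real.exp_add]
  congr 1
  simp

variable [FiniteDimensional ℝ E]

theorem hasLineDerivAt_inner_apply_self (hT : T.IsSymmetric) (ξ v : E) :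
    HasLineDerivAt ℝ (fun ζ => ((inner ℝ (T ζ) ζ : ℝ) : ℂ)) (2 * (inner ℝ (T ξ) v : ℝ)) ξ v := by
  have h1 : HasFDerivAt (fun ζ => T ζ) (LinearMap.toContinuousLinearMap T) ξ :=
    (LinearMap.toContinuousLinearMap T).hasFDerivAt
  have h2 := ((h1.inner ℝ (hasFDerivAt_id ξ)).hasLineDerivAt v)
  have h3 : HasDerivAt (fun y : ℝ => ((inner ℝ (T (ξ + y • v)) (ξ + y • v) : ℝ) : ℂ)) _ 0 :=
    HasDerivAt.ofReal_comp h2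
  refine h3.congr_deriv ?_
  simp [hT v ξ, real_inner_comm]
  ring

theorem hasLineDerivAt_gaussExp (hS : S.IsSymmetric) (hT : T.IsSymmetric) (η ξ v : E) :
    HasLineDerivAt ℝ (gaussExp S T η) ((Complex.I * (inner ℝ v η : ℝ)
      + Complex.I * (inner ℝ (T ξ) v : ℝ) - (inner ℝ (S ξ) v : ℝ)) * gaussExp S T η ξ) ξ v := by
  have h1 : HasDerivAt (fun y : ℝ => ((inner ℝ (ξ + y • v) η : ℝ) : ℂ)) (inner ℝ v η : ℝ) 0 := by
    have h2 := (((hasFDerivAt_id ξ).inner ℝ (hasFDerivAt_const η ξ)).hasLineDerivAt v)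
    have h3 : HasDerivAt (fun y : ℝ => ((inner ℝ (ξ + y • v) η : ℝ) : ℂ)) _ 0 :=
      HasDerivAt.ofReal_comp h2
    exact h3.congr_deriv (by simp)
  have h2 : HasDerivAt _ _ (0 : ℝ) := hasLineDerivAt_inner_apply_self hS ξ v
  have h3 : HasDerivAt _ _ (0 : ℝ) := hasLineDerivAt_inner_apply_self hT ξ v
  have h4 := (h1.const_mul Complex.I).cexp.fun_mul
    (((h3.fun_add (h2.const_mul Complex.I)).const_mul (Complex.I / 2)).cexp)
  refine HasDerivAt.congr_deriv h4 ?_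
  simp only [gaussExp, zero_smul, add_zero]
  have := Complex.I_sq
  linear_combination ((inner ℝ (S ξ) v : ℝ) * Complex.exp (Complex.I * ((inner ℝ ξ η : ℝ) : ℂ)) *
    Complex.exp (Complex.I / 2 *
      (((inner ℝ (T ξ) ξ : ℝ) : ℂ) + Complex.I * ((inner ℝ (S ξ) ξ : ℝ) : ℂ)))) * this

theorem continuous_gaussExp (η : E) : Continuous (gaussExp S T η) := by
  have hS : Continuous S := LinearMap.continuous_of_finiteDimensional S
  have hT : Continuous T := LinearMap.continuous_of_finiteDimensional T
  unfold gaussExp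
  fun_prop

variable [MeasurableSpace E] [BorelSpace E] {ι : Type*} [Fintype ι] (b : Module.Basis ι ℝ E)

theorem integrable_exp_neg_mul_sq_norm {c : ℝ} (hc : 0 < c) :
    Integrable (fun ξ : E => Real.exp (-c * ‖ξ‖ ^ 2)) := by
  have := (GaussianFourier.integrable_cexp_neg_mul_sq_norm_add (V := E) (b := (c : ℂ))
    (by simpa using hc) 0 0).norm
  refine this.congr (Filter.Eventually.of_forall fun ξ => ?_)
  simp only [Complex.norm_exp]
  congr 1
  simp [← Complex.ofReal_pow]

theorem integrable_polyEvalReal_mul_gaussExp {c : ℝ} (hc : 0 < c)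
    (hS : ∀ ξ, c * ‖ξ‖ ^ 2 ≤ inner ℝ (S ξ) ξ) (η : E) (q : MvPolynomial ι ℂ) :
    Integrable (fun ξ => polyEvalReal b q ξ * gaussExp S T η ξ) := by
  -- The Gaussian decays at least like exp(-(c/2)‖ξ‖²); the polynomial may use up c/4 of it.
  obtain ⟨C, hC⟩ := exists_norm_polyEvalReal_le b q (show 0 < c / 4 by positivity)
  refine Integrable.mono' ((integrable_exp_neg_mul_sq_norm (E := E)
    (show 0 < c / 4 by positivity)).const_mul C)
    ((continuous_polyEvalReal b q).mul (continuous_gaussExp η)).aestronglyMeasurable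
    (Filter.Eventually.of_forall fun ξ => ?_)
  rw [norm_mul, norm_gaussExp]
  calc _ ≤ C * Real.exp (c / 4 * ‖ξ‖ ^ 2) * Real.exp (-(c / 2) * ‖ξ‖ ^ 2) := by
        refine mul_le_mul (hC ξ) (Real.exp_le_exp.2 ?_) (Real.exp_nonneg _)
          ((norm_nonneg _).trans (hC ξ))
        have := hS ξ
        nlinarith
    _ = C * Real.exp (-(c / 4) * ‖ξ‖ ^ 2) := by
        rw [mul_assoc, ← Real.exp_add]
        congr 2
        ring

/-- The functional `q ↦ ∫ q(ξ) gaussExp S T η ξ dξ`. -/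
def gaussFunctional {c : ℝ} (hc : 0 < c) (hS : ∀ ξ, c * ‖ξ‖ ^ 2 ≤ inner ℝ (S ξ) ξ)
    (T : Module.End ℝ E) (η : E) : MvPolynomial ι ℂ →ₗ[ℂ] ℂ where
  toFun q := ∫ ξ, polyEvalReal b q ξ * gaussExp S T η ξ
  map_add' p q := by
    rw [← integral_add (integrable_polyEvalReal_mul_gaussExp b hc hS η p)
      (integrable_polyEvalReal_mul_gaussExp b hc hS η q)]
    simp [polyEvalReal, add_mul]
  map_smul' a q := by
    rw [RingHom.id_apply, smul_eq_mul, ← integral_const_mul]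
    simp [polyEvalReal, MvPolynomial.smul_eval, mul_assoc]

/-- The linear polynomial arising from the derivative of the exponential along `b j`. -/
def derivPoly (S T : Module.End ℝ E) (η : E) (j : ι) : MvPolynomial ι ℂ :=
  ∑ l, MvPolynomial.C (((inner ℝ (S (b l)) (b j) : ℝ) : ℂ)
      - Complex.I * (inner ℝ (T (b l)) (b j) : ℝ)) * MvPolynomial.X l
    - MvPolynomial.C (Complex.I * (inner ℝ (b j) η : ℝ))

omit [FiniteDimensional ℝ E] [MeasurableSpace E] [BorelSpace E] in
theorem polyEvalReal_derivPoly (η : E) (j : ι) (ξ : E) :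
    polyEvalReal b (derivPoly b S T η j) ξ = ((inner ℝ (S ξ) (b j) : ℝ) : ℂ)
      - Complex.I * (inner ℝ (T ξ) (b j) : ℝ) - Complex.I * (inner ℝ (b j) η : ℝ) := by
  have h : ∀ R : Module.End ℝ E, inner ℝ (R ξ) (b j)
      = ∑ l, b.repr ξ l * inner ℝ (R (b l)) (b j) := by
    intro R
    conv_lhs => rw [← b.sum_repr ξ]
    rw [map_sum, sum_inner]
    exact Finset.sum_congr rfl fun l _ => by rw [map_smul, real_inner_smul_left]
  rw [h S, h T]
  simp only [polyEvalReal, derivPoly, map_sub, map_sum, map_mul, MvPolynomial.eval_C,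
    MvPolynomial.eval_X, sub_mul, Finset.sum_sub_distrib, Complex.ofReal_sum, Complex.ofReal_mul,
    Finset.mul_sum]
  congr 2
  · exact Finset.sum_congr rfl fun l _ => mul_comm _ _
  · exact Finset.sum_congr rfl fun l _ => by ring

/-- Integration by parts: along b j the Gaussian has derivative -`derivPoly` times itself. -/
theorem gaussFunctional_pderiv {c : ℝ} (hc : 0 < c) (hS : ∀ ξ, c * ‖ξ‖ ^ 2 ≤ inner ℝ (S ξ) ξ)
    (hSs : S.IsSymmetric) (hT : T.IsSymmetric) (η : E) (j : ι) (q : MvPolynomial ι ℂ) :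
    gaussFunctional b hc hS T η (MvPolynomial.pderiv j q)
      = gaussFunctional b hc hS T η (derivPoly b S T η j * q) := by
  classical
  have hint := fun q => integrable_polyEvalReal_mul_gaussExp (T := T) b hc hS η q
  have hq : ∀ ξ, HasLineDerivAt ℝ (polyEvalReal b q)
      (polyEvalReal b (MvPolynomial.pderiv j q) ξ) ξ (b j) := by
    intro ξ
    have := (hasFDerivAt_polyEvalReal b q ξ).hasLineDerivAt (b j)
    convert! this using 1
    simp only [sum_apply, smul_apply, coordCLM_apply,
      smul_eq_mul, Module.Basis.repr_self]
    rw [Finset.sum_eq_single j (fun i _ hij => by simp [hij.symm]) (by simp)]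
    simp
  have hprod : ∀ ξ, polyEvalReal b q ξ * ((Complex.I * (inner ℝ (b j) η : ℝ)
      + Complex.I * (inner ℝ (T ξ) (b j) : ℝ) - (inner ℝ (S ξ) (b j) : ℝ)) * gaussExp S T η ξ)
      = -(polyEvalReal b (derivPoly b S T η j * q) ξ * gaussExp S T η ξ) := by
    intro ξ
    have : polyEvalReal b (derivPoly b S T η j * q) ξ
      = polyEvalReal b (derivPoly b S T η j) ξ * polyEvalReal b q ξ := by simp [polyEvalReal]
    rw [this, polyEvalReal_derivPoly]
    ring
  have key := integral_bilinear_hasLineDerivAt_right_eq_neg_left_of_integrable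
    (μ := (volume : Measure E)) (v := b j) (f := polyEvalReal b q)
    (f' := polyEvalReal b (MvPolynomial.pderiv j q)) (g := gaussExp S T η)
    (g' := fun ξ => (Complex.I * (inner ℝ (b j) η : ℝ)
      + Complex.I * (inner ℝ (T ξ) (b j) : ℝ) - (inner ℝ (S ξ) (b j) : ℝ)) * gaussExp S T η ξ)
    (B := ContinuousLinearMap.mul ℝ ℂ) ?_ ?_ ?_ (fun ξ _ => hq ξ)
    (fun ξ _ => hasLineDerivAt_gaussExp hSs hT η ξ (b j))
  · simp only [ContinuousLinearMap.mul_apply'] at key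
    rw [integral_congr_ae (Filter.Eventually.of_forall hprod), integral_neg, neg_inj] at key
    exact key.symm
  · simpa using hint _
  · simp only [ContinuousLinearMap.mul_apply']
    exact (hint (derivPoly b S T η j * q)).neg.congr
      (Filter.Eventually.of_forall fun ξ => (hprod ξ).symm)
  · simpa using hint q

end GaussianIntegral

/-! ### Evaluation of Gaussian integrals -/

section DualBasis

variable {E : Type*} [NormedAddCommGroup E] [InnerProductSpace ℝ E] [FiniteDimensional ℝ E]
  {ι : Type*} (b : Module.Basis ι ℝ E)

/-- The dual basis of `b` with respect to the inner product. -/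
def dualVec (i : ι) : E :=
  (InnerProductSpace.toDual ℝ E).symm (LinearMap.toContinuousLinearMap (b.coord i))

theorem inner_dualVec (i : ι) (ξ : E) : inner ℝ (dualVec b i) ξ = b.repr ξ i := by
  simp [dualVec]

variable [Fintype ι]

theorem sum_inner_dualVec_mul (u w : E) :
    ∑ j, inner ℝ u (dualVec b j) * inner ℝ w (b j) = inner ℝ u w := by
  conv_rhs => rw [← b.sum_repr u]
  rw [sum_inner]
  refine Finset.sum_congr rfl fun j _ => ?_
  rw [real_inner_smul_left, real_inner_comm, inner_dualVec, real_inner_comm w]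

/-- The coefficients of the inverse of `S - iT` when `-S'` and `-T'` are the imaginary and real
parts of `(T + iS)⁻¹`. -/
def invCoeff (S' T' : Module.End ℝ E) (i j : ι) : ℂ :=
  ((inner ℝ (S' (dualVec b i)) (dualVec b j) : ℝ) : ℂ)
    - Complex.I * (inner ℝ (T' (dualVec b i)) (dualVec b j) : ℝ)

variable {S T S' T' : Module.End ℝ E}

/-- The hypotheses say (T + iS)(T' + iS') = -1, that is, S' - iT' inverts S - iT. Applying this
inverse to the linear system given by `derivPoly` isolates each X i and produces the centre (T' +
iS')η. The dual basis appears because b need not be orthonormal. -/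
theorem sum_invCoeff_mul_derivPoly (hS : S.IsSymmetric) (hT : T.IsSymmetric)
    (hS' : S'.IsSymmetric) (hT' : T'.IsSymmetric)
    (h1 : ∀ η, S (S' η) - T (T' η) = η) (h2 : ∀ η, T (S' η) + S (T' η) = 0) (η : E) (i : ι) :
    ∑ j, MvPolynomial.C (invCoeff b S' T' i j) * derivPoly b S T η j
      = MvPolynomial.X i - MvPolynomial.C
        ((b.repr (T' η) i : ℂ) + Complex.I * (b.repr (S' η) i : ℂ)) := by
  classical
  have hdelta : ∀ l, ∑ j, invCoeff b S' T' i j * (((inner ℝ (S (b l)) (b j) : ℝ) : ℂ)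
      - Complex.I * (inner ℝ (T (b l)) (b j) : ℝ)) = if i = l then 1 else 0 := by
    intro l
    have e1 := sum_inner_dualVec_mul b (S' (dualVec b i)) (S (b l))
    have e2 := sum_inner_dualVec_mul b (S' (dualVec b i)) (T (b l))
    have e3 := sum_inner_dualVec_mul b (T' (dualVec b i)) (S (b l))
    have e4 := sum_inner_dualVec_mul b (T' (dualVec b i)) (T (b l))
    rw [← hS] at e1 e3
    rw [← hT] at e2 e4
    have e5 : inner ℝ (S (S' (dualVec b i))) (b l) - inner ℝ (T (T' (dualVec b i))) (b l)
        = if i = l then 1 else 0 := by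
      rw [← inner_sub_left, h1, inner_dualVec, b.repr_self, Finsupp.single_apply]
      simp [eq_comm]
    have e6 : inner ℝ (T (S' (dualVec b i))) (b l) + inner ℝ (S (T' (dualVec b i))) (b l) = 0 := by
      rw [← inner_add_left, h2, inner_zero_left]
    rw [← e1, ← e4, ← Finset.sum_sub_distrib] at e5
    rw [← e2, ← e3, ← Finset.sum_add_distrib] at e6
    have e5' := congr_arg (fun r : ℝ => (r : ℂ)) e5
    have e6' := congr_arg (fun r : ℝ => (r : ℂ)) e6
    push_cast at e5' e6'
    rw [show (if i = l then (1 : ℂ) else 0) = ((if i = l then 1 else 0 : ℝ) : ℂ) by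
      split_ifs <;> simp, ← e5', ← add_zero (∑ j, _ : ℂ), ← mul_zero Complex.I, ← e6', Finset.mul_sum,
      ← Finset.sum_add_distrib]
    refine Finset.sum_congr rfl fun j _ => ?_
    rw [invCoeff]
    linear_combination ((inner ℝ (T' (dualVec b i)) (dualVec b j) : ℝ) : ℂ) *
      ((inner ℝ (T (b l)) (b j) : ℝ) : ℂ) * Complex.I_sq
  have hm : ∑ j, invCoeff b S' T' i j * (Complex.I * (inner ℝ (b j) η : ℝ))
      = (b.repr (T' η) i : ℂ) + Complex.I * (b.repr (S' η) i : ℂ) := by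
    have e1 := sum_inner_dualVec_mul b (S' (dualVec b i)) η
    have e2 := sum_inner_dualVec_mul b (T' (dualVec b i)) η
    rw [hS', inner_dualVec] at e1
    rw [hT', inner_dualVec] at e2
    rw [← e1, ← e2]
    push_cast
    rw [Finset.mul_sum, ← Finset.sum_add_distrib]
    refine Finset.sum_congr rfl fun j _ => ?_
    rw [invCoeff, real_inner_comm η]
    linear_combination -((inner ℝ (T' (dualVec b i)) (dualVec b j) : ℝ) : ℂ) *
      ((inner ℝ η (b j) : ℝ) : ℂ) * Complex.I_sq
  have hexp : ∀ j, MvPolynomial.C (invCoeff b S' T' i j) * derivPoly b S T η j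
      = ∑ l, MvPolynomial.C (invCoeff b S' T' i j * (((inner ℝ (S (b l)) (b j) : ℝ) : ℂ)
          - Complex.I * (inner ℝ (T (b l)) (b j) : ℝ))) * MvPolynomial.X l
        - MvPolynomial.C (invCoeff b S' T' i j * (Complex.I * (inner ℝ (b j) η : ℝ))) := by
    intro j
    rw [derivPoly, mul_sub, Finset.mul_sum]
    congr 1
    · exact Finset.sum_congr rfl fun l _ => by rw [MvPolynomial.C_mul, mul_assoc]
    · simp only [MvPolynomial.C_mul]
  rw [Finset.sum_congr rfl fun j _ => hexp j, Finset.sum_sub_distrib]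
  congr 1
  · rw [Finset.sum_comm]
    simp only [← Finset.sum_mul, ← map_sum, hdelta]
    rw [Finset.sum_eq_single i (fun l _ hl => by simp [hl.symm]) (by simp)]
    simp
  · rw [← map_sum, ← hm]

variable [MeasurableSpace E] [BorelSpace E]

/-- The Gaussian integral of a polynomial annihilated by the second order operator attached to
the inverse of the quadratic form. -/
theorem integral_polyEvalReal_mul_gaussExp {c : ℝ} (hc : 0 < c)
    (hpos : ∀ ξ, c * ‖ξ‖ ^ 2 ≤ inner ℝ (S ξ) ξ) (hS : S.IsSymmetric) (hT : T.IsSymmetric)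
    (hS' : S'.IsSymmetric) (hT' : T'.IsSymmetric)
    (h1 : ∀ η, S (S' η) - T (T' η) = η) (h2 : ∀ η, T (S' η) + S (T' η) = 0) (η : E)
    {q : MvPolynomial ι ℂ} (hq : quadOp (invCoeff b S' T') q = 0) :
    ∫ ξ, polyEvalReal b q ξ * gaussExp S T η ξ
      = (∫ ξ, gaussExp S T η ξ) * polyEval b q
          ((1 : ℂ) ⊗ₜ[ℝ] T' η + Complex.I ⊗ₜ[ℝ] S' η) := by
  have h := functional_eq_eval (gaussFunctional b hc hpos T η) (g := invCoeff b S' T')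
    (m := fun i => (b.repr (T' η) i : ℂ) + Complex.I * (b.repr (S' η) i : ℂ)) ?_ hq
  · have e1 : gaussFunctional b hc hpos T η 1 = ∫ ξ, gaussExp S T η ξ := by
      simp [gaussFunctional, polyEvalReal]
    rw [e1] at h
    have e2 : polyEval b q ((1 : ℂ) ⊗ₜ[ℝ] T' η + Complex.I ⊗ₜ[ℝ] S' η)
        = MvPolynomial.eval
          (fun i => (b.repr (T' η) i : ℂ) + Complex.I * (b.repr (S' η) i : ℂ)) q := by
      simp [polyEval, Module.Basis.baseChange_repr_tmul, mul_comm]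
    rw [e2]
    exact h
  · intro i q
    rw [← sum_invCoeff_mul_derivPoly b hS hT hS' hT' h1 h2, Finset.sum_mul, map_sum]
    refine Finset.sum_congr rfl fun j _ => ?_
    rw [gaussFunctional_pderiv b hc hpos hS hT, mul_assoc, ← MvPolynomial.smul_eq_C_mul, map_smul,
      smul_eq_mul]

end DualBasis

/-! ### The Gaussian integral without polynomial factor. -/

section Evaluation

variable {E : Type*} [NormedAddCommGroup E] [InnerProductSpace ℝ E] [FiniteDimensional ℝ E]
  {T W V : Module.End ℝ E}

omit [FiniteDimensional ℝ E] in
theorem isSymmetric_of_inverse (hW : W.IsSymmetric) (hWV : W * V = 1) : V.IsSymmetric := by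
  intro ξ η
  have h : ∀ ζ, W (V ζ) = ζ := LinearMap.congr_fun hWV
  conv_lhs => rw [← h η]
  rw [← hW, h]

theorem exists_le_inner_mul_self (hW : W.IsSymmetric) (hVW : V * W = 1) :
    ∃ c : ℝ, 0 < c ∧ ∀ ξ, c * ‖ξ‖ ^ 2 ≤ inner ℝ ((W * W) ξ) ξ := by
  -- The added 1 keeps K positive even when E = 0.
  set K := ‖LinearMap.toContinuousLinearMap V‖ + 1 with hK
  have hK0 : 0 < K := by positivity
  refine ⟨(K ^ 2)⁻¹, by positivity, fun ξ => ?_⟩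
  have h1 : ‖ξ‖ ≤ K * ‖W ξ‖ := by
    have h2 : V (W ξ) = ξ := LinearMap.congr_fun hVW ξ
    calc ‖ξ‖ = ‖LinearMap.toContinuousLinearMap V (W ξ)‖ := by
            rw [LinearMap.coe_toContinuousLinearMap', h2]
      _ ≤ ‖LinearMap.toContinuousLinearMap V‖ * ‖W ξ‖ := ContinuousLinearMap.le_opNorm _ _
      _ ≤ K * ‖W ξ‖ := mul_le_mul_of_nonneg_right (by linarith) (norm_nonneg _)
  rw [Module.End.mul_apply, hW, real_inner_self_eq_norm_sq, inv_mul_le_iff₀ (by positivity),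
    ← mul_pow]
  exact pow_le_pow_left₀ (norm_nonneg _) h1 2

variable [MeasurableSpace E] [BorelSpace E]

theorem integral_eq_abs_det_mul_integral_coord (hWV : W * V = 1)
    (e : OrthonormalBasis (Fin (Module.finrank ℝ E)) ℝ E) {f : E → ℂ} (hf : Continuous f) :
    ∫ ξ, f ξ = ((|LinearMap.det V| : ℝ) : ℂ) *
      ∫ v : Fin (Module.finrank ℝ E) → ℝ, f (V (∑ i, v i • e i)) := by
  have hdet : LinearMap.det V ≠ 0 := by
    intro h
    have := congr_arg LinearMap.det hWV
    rw [map_mul, h, mul_zero, map_one] at this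
    exact zero_ne_one this
  have hVc : Continuous V := LinearMap.continuous_of_finiteDimensional V
  have h1 : ∫ v : E, f (V v) = ((|LinearMap.det V|⁻¹ : ℝ) : ℂ) * ∫ ξ, f ξ := by
    rw [← integral_map hVc.measurable.aemeasurable hf.aestronglyMeasurable,
      Measure.map_linearMap_addHaar_eq_smul_addHaar volume hdet, integral_smul_measure,
      ENNReal.toReal_ofReal (abs_nonneg _), abs_inv, Complex.real_smul]
  have h2 : ∫ v : Fin (Module.finrank ℝ E) → ℝ, f (V (∑ i, v i • e i)) = ∫ v : E, f (V v) := by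
    rw [← e.measurePreserving_repr_symm.integral_comp
      e.repr.symm.toHomeomorph.measurableEmbedding,
      ← (PiLp.volume_preserving_toLp (Fin (Module.finrank ℝ E))).integral_comp
      (MeasurableEquiv.toLp 2 _).measurableEmbedding]
    refine integral_congr_ae (Filter.Eventually.of_forall fun v => ?_)
    simp only [e.sum_repr_symm]
  rw [h2, h1, ← mul_assoc, ← Complex.ofReal_mul, mul_inv_cancel₀ (abs_ne_zero.2 hdet)]
  simp

/-- The Gaussian integral, in a basis that diagonalizes both quadratic forms. -/
theorem integral_gaussExp_eq (hW : W.IsSymmetric) (hWV : W * V = 1) (hVW : V * W = 1)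
    (e : OrthonormalBasis (Fin (Module.finrank ℝ E)) ℝ E) {t : Fin (Module.finrank ℝ E) → ℝ}
    (ht : ∀ i, V (T (V (e i))) = t i • e i) (η : E) :
    ∫ ξ, gaussExp (W * W) T η ξ = ((|LinearMap.det V| : ℝ) : ℂ) *
      ((∏ i, (2 * Real.pi / (1 - Complex.I * t i)) ^ ((2 : ℕ) : ℂ)⁻¹) *
        Complex.exp (-(1 / 2) * ∑ i, (inner ℝ (e i) (V η) : ℝ) ^ 2 / (1 - Complex.I * t i))) := by
  have hV := isSymmetric_of_inverse hW hWV
  have hVW' : ∀ ζ, V (W ζ) = ζ := LinearMap.congr_fun hVW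
  have hWV' : ∀ ζ, W (V ζ) = ζ := LinearMap.congr_fun hWV
  rw [integral_eq_abs_det_mul_integral_coord hWV e (continuous_gaussExp η)]
  congr 1
  -- After ξ = V(∑ v_i e_i) the two forms become ∑ v_i² and ∑ t_i v_i², so the integral factors.
  -- Each 1 - i t_i has real part 1, so the principal square roots are legitimate.
  have hint : ∀ v : Fin (Module.finrank ℝ E) → ℝ, gaussExp (W * W) T η (V (∑ i, v i • e i))
      = Complex.exp (-∑ i, (1 - Complex.I * t i) / 2 * (v i : ℂ) ^ 2
        + ∑ i, Complex.I * (inner ℝ (e i) (V η) : ℝ) * v i) := by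
    intro v
    have e1 : inner ℝ (V (∑ i, v i • e i)) η = ∑ i, v i * inner ℝ (e i) (V η) := by
      rw [hV, sum_inner]
      exact Finset.sum_congr rfl fun i _ => real_inner_smul_left _ _ _
    have e2 : inner ℝ ((W * W) (V (∑ i, v i • e i))) (V (∑ i, v i • e i)) = ∑ i, v i ^ 2 := by
      rw [Module.End.mul_apply, hW, hWV', sum_inner]
      refine Finset.sum_congr rfl fun i _ => ?_
      rw [real_inner_smul_left, e.orthonormal.inner_right_fintype]
      ring
    have e3 : inner ℝ (T (V (∑ i, v i • e i))) (V (∑ i, v i • e i)) = ∑ i, t i * v i ^ 2 := by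
      rw [← hV, map_sum, map_sum, map_sum, sum_inner]
      refine Finset.sum_congr rfl fun i _ => ?_
      rw [map_smul, map_smul, map_smul, ht, real_inner_smul_left, real_inner_smul_left,
        e.orthonormal.inner_right_fintype]
      ring
    rw [gaussExp, e1, e2, e3, ← Complex.exp_add]
    congr 1
    push_cast
    simp only [Finset.mul_sum, ← Finset.sum_add_distrib, ← Finset.sum_neg_distrib]
    refine Finset.sum_congr rfl fun i _ => ?_
    linear_combination ((v i : ℂ) ^ 2 / 2) * Complex.I_sq
  rw [integral_congr_ae (Filter.Eventually.of_forall hint),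
    GaussianFourier.integral_cexp_neg_sum_mul_add, Finset.prod_mul_distrib, ← Complex.exp_sum,
    Finset.mul_sum]
  · congr 1
    · refine Finset.prod_congr rfl fun i _ => ?_
      congr 1
      · rw [div_div_eq_mul_div, mul_comm]
      · norm_num
    · congr 1
      refine Finset.sum_congr rfl fun i _ => ?_
      have h0 : (1 - Complex.I * t i : ℂ) ≠ 0 := by
        intro h0
        have := congr_arg Complex.re h0
        simp at this
      rw [mul_pow, Complex.I_sq]
      field_simp
      ring
  · intro i
    simp

omit [MeasurableSpace E] [BorelSpace E] in
theorem exists_diagonalization (hT : T.IsSymmetric) (hV : V.IsSymmetric) :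
    ∃ (e : OrthonormalBasis (Fin (Module.finrank ℝ E)) ℝ E) (t : Fin (Module.finrank ℝ E) → ℝ),
      ∀ i, V (T (V (e i))) = t i • e i := by
  have hs : (V * T * V).IsSymmetric := by
    intro ξ η
    simp only [Module.End.mul_apply]
    rw [hV, hT, hV]
  exact ⟨hs.eigenvectorBasis rfl, hs.eigenvalues rfl, fun i => hs.apply_eigenvectorBasis rfl i⟩

/-- In the eigenbasis of VTV the relations between S', T' and η decouple into two scalar equations
per coordinate, and the exponents are compared term by term. -/
theorem integral_gaussExp_eq_mul_exp (hT : T.IsSymmetric) (hW : W.IsSymmetric)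
    (hWV : W * V = 1) (hVW : V * W = 1)
    {S' T' : Module.End ℝ E}
    (h1 : ∀ η, (W * W) (S' η) - T (T' η) = η) (h2 : ∀ η, T (S' η) + (W * W) (T' η) = 0) (η : E) :
    ∫ ξ, gaussExp (W * W) T η ξ = (∫ ξ, gaussExp (W * W) T 0 ξ) *
      Complex.exp (Complex.I / 2 *
        (((inner ℝ (T' η) η : ℝ) : ℂ) + Complex.I * (inner ℝ (S' η) η : ℝ))) := by
  have hV := isSymmetric_of_inverse hW hWV
  have hVW' : ∀ ζ, V (W ζ) = ζ := LinearMap.congr_fun hVW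
  obtain ⟨e, t, ht⟩ := exists_diagonalization hT hV
  rw [integral_gaussExp_eq hW hWV hVW e ht, integral_gaussExp_eq hW hWV hVW e ht, mul_assoc,
    mul_assoc]
  congr 2
  simp only [map_zero, inner_zero_right, Complex.ofReal_zero]
  rw [← Complex.exp_add]
  congr 1
  have hdiag : ∀ (ζ : E) i, inner ℝ (e i) (V (T (V ζ))) = t i * inner ℝ (e i) ζ := by
    intro ζ i
    rw [← hV, ← hT, ← hV, ht, real_inner_smul_left]
  have hin : ∀ ζ, inner ℝ ζ η = ∑ i, inner ℝ (e i) (W ζ) * inner ℝ (e i) (V η) := by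
    intro ζ
    conv_lhs => rw [← hVW' ζ, hV, ← e.sum_inner_mul_inner]
    exact Finset.sum_congr rfl fun i _ => by rw [real_inner_comm]
  rw [hin, hin]
  push_cast
  simp only [Finset.mul_sum, ← Finset.sum_add_distrib]
  refine Finset.sum_congr rfl fun i _ => ?_
  have r1 : inner ℝ (e i) (W (S' η)) - t i * inner ℝ (e i) (W (T' η)) = inner ℝ (e i) (V η) := by
    rw [← hdiag, hVW', ← inner_sub_right]
    conv_rhs => rw [← h1 η, map_sub, Module.End.mul_apply, hVW']
  have r2 : t i * inner ℝ (e i) (W (S' η)) + inner ℝ (e i) (W (T' η)) = 0 := by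
    rw [← hdiag, hVW', ← inner_add_right]
    have := congr_arg V (h2 η)
    rw [map_add, Module.End.mul_apply, hVW', map_zero] at this
    rw [this, inner_zero_right]
  have h0 : (1 - Complex.I * t i : ℂ) ≠ 0 := by
    intro h0
    have := congr_arg Complex.re h0
    simp at this
  have r2' : inner ℝ (e i) (W (T' η)) = -(t i * inner ℝ (e i) (W (S' η))) := by linarith
  rw [← r1, r2']
  push_cast
  rw [zero_pow two_ne_zero, zero_div, mul_zero, zero_add]
  generalize ((inner ℝ (e i) (W (S' η)) : ℝ) : ℂ) = y at *
  generalize (t i : ℂ) = s at *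
  -- With y the coordinate of W(S'η), the coordinate of Vη is y(1 + s²), and 1 + s² = (1 - is)(1 +
  -- is).
  have hdiv : (y - s * -(s * y)) ^ 2 / (1 - Complex.I * s)
      = y ^ 2 * (1 + s ^ 2) * (1 + Complex.I * s) := by
    rw [div_eq_iff h0]
    linear_combination y ^ 2 * (1 + s ^ 2) * s ^ 2 * Complex.I_sq
  rw [hdiv]
  linear_combination -(1 / 2) * y ^ 2 * (1 + s ^ 2) * Complex.I_sq

end Evaluation

/-! ### The constant of the Gaussian integral. -/

section DetSquare

variable {E : Type*} [NormedAddCommGroup E] [InnerProductSpace ℝ E] [FiniteDimensional ℝ E]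
  {T W V : Module.End ℝ E}

/-- Factor W² - iT as W(1 - iVTV)W. -/
theorem det_baseChange_sub (hWV : W * V = 1) (hVW : V * W = 1)
    (e : OrthonormalBasis (Fin (Module.finrank ℝ E)) ℝ E) {t : Fin (Module.finrank ℝ E) → ℝ}
    (ht : ∀ i, V (T (V (e i))) = t i • e i) :
    LinearMap.det (LinearMap.baseChange ℂ (W * W) - Complex.I • LinearMap.baseChange ℂ T)
      = ((LinearMap.det W : ℝ) : ℂ) ^ 2 * ∏ i, (1 - Complex.I * t i) := by
  set D : ℂ ⊗[ℝ] E →ₗ[ℂ] ℂ ⊗[ℝ] E :=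
    LinearMap.id - Complex.I • LinearMap.baseChange ℂ (V * T * V) with hD
  have hVW' : ∀ ζ, V (W ζ) = ζ := LinearMap.congr_fun hVW
  have hWV' : ∀ ζ, W (V ζ) = ζ := LinearMap.congr_fun hWV
  have hfac : LinearMap.baseChange ℂ (W * W) - Complex.I • LinearMap.baseChange ℂ T
      = LinearMap.baseChange ℂ W ∘ₗ D ∘ₗ LinearMap.baseChange ℂ W := by
    refine TensorProduct.AlgebraTensorModule.ext fun a ξ => ?_
    simp [hD, hVW', hWV']
  have hdet : LinearMap.det D = ∏ i, (1 - Complex.I * t i) := by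
    rw [← LinearMap.det_toMatrix (e.toBasis.baseChange ℂ), ← Matrix.det_diagonal]
    congr 1
    ext i j
    rw [LinearMap.toMatrix_apply, Module.Basis.baseChange_apply, hD, LinearMap.sub_apply,
      LinearMap.id_apply, LinearMap.smul_apply, LinearMap.baseChange_tmul, e.coe_toBasis,
      Module.End.mul_apply, Module.End.mul_apply, ht, map_sub, map_smul, Finsupp.sub_apply,
      Finsupp.smul_apply, Module.Basis.baseChange_repr_tmul, Module.Basis.baseChange_repr_tmul,
      map_smul, ← e.coe_toBasis, e.toBasis.repr_self, Matrix.diagonal_apply]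
    by_cases hij : i = j
    · subst hij; simp
    · simp [hij]
  rw [hfac, LinearMap.det_comp, LinearMap.det_comp, hdet, LinearMap.det_baseChange]
  simp only [Complex.coe_algebraMap]
  ring

variable [MeasurableSpace E] [BorelSpace E]

/-- Squaring removes the square roots from the product formula; the sign lost here is recovered
later by continuity on the tube. -/
theorem sq_integral_gaussExp_mul_det (hT : T.IsSymmetric) (hW : W.IsSymmetric)
    (hWV : W * V = 1) (hVW : V * W = 1) :
    (∫ ξ, gaussExp (W * W) T 0 ξ) ^ 2 *
        LinearMap.det (LinearMap.baseChange ℂ (W * W) - Complex.I • LinearMap.baseChange ℂ T)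
      = (2 * Real.pi) ^ Module.finrank ℝ E := by
  obtain ⟨e, t, ht⟩ := exists_diagonalization hT (isSymmetric_of_inverse hW hWV)
  have h0 : ∀ i, (1 - Complex.I * t i : ℂ) ≠ 0 := by
    intro i h0
    have := congr_arg Complex.re h0
    simp at this
  have hdet : ((LinearMap.det V : ℝ) : ℂ) * (LinearMap.det W : ℝ) = 1 := by
    rw [← Complex.ofReal_mul, ← map_mul, hVW, map_one, Complex.ofReal_one]
  have habs : ((|LinearMap.det V| : ℝ) : ℂ) ^ 2 = ((LinearMap.det V : ℝ) : ℂ) ^ 2 := by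
    rw [← Complex.ofReal_pow, sq_abs, Complex.ofReal_pow]
  have hprod : (∏ i, (2 * Real.pi / (1 - Complex.I * t i)) ^ ((2 : ℕ) : ℂ)⁻¹) ^ 2
      * ∏ i, (1 - Complex.I * t i) = (2 * Real.pi) ^ Module.finrank ℝ E := by
    rw [← Finset.prod_pow, ← Finset.prod_mul_distrib]
    rw [Finset.prod_congr rfl (g := fun _ => (2 * Real.pi : ℂ)) fun i _ => by
      rw [Complex.cpow_nat_inv_pow _ two_ne_zero, div_mul_cancel₀ _ (h0 i)]]
    simp
  rw [det_baseChange_sub hWV hVW e ht, integral_gaussExp_eq hW hWV hVW e ht, ← hprod]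
  simp only [map_zero, inner_zero_right, Complex.ofReal_zero, ne_eq, OfNat.ofNat_ne_zero,
    not_false_eq_true, zero_pow, zero_div, Finset.sum_const_zero, mul_zero, Complex.exp_zero,
    mul_one, mul_pow, habs]
  linear_combination ((∏ i, (2 * Real.pi / (1 - Complex.I * t i)) ^ ((2 : ℕ) : ℂ)⁻¹) ^ 2
      * ∏ i, (1 - Complex.I * t i)) *
    (((LinearMap.det V : ℝ) : ℂ) * (LinearMap.det W : ℝ) + 1) * hdet

theorem integral_gaussExp_zero_zero (hW : W.IsSymmetric) (hWV : W * V = 1) (hVW : V * W = 1) :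
    ∫ ξ, gaussExp (W * W) 0 0 ξ = (((2 * Real.pi) ^ ((Module.finrank ℝ E : ℝ) / 2) *
      LinearMap.det (W * W) ^ (-(1 / 2) : ℝ) : ℝ) : ℂ) := by
  have e := stdOrthonormalBasis ℝ E
  rw [integral_gaussExp_eq hW hWV hVW e (t := 0) (by simp)]
  have hdet : LinearMap.det V * LinearMap.det W = 1 := by
    rw [← map_mul, hVW, map_one]
  have h1 : LinearMap.det (W * W) ^ (-(1 / 2) : ℝ) = |LinearMap.det V| := by
    rw [map_mul, Real.rpow_neg (mul_self_nonneg _), ← Real.sqrt_eq_rpow, Real.sqrt_mul_self_eq_abs,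
      ← abs_inv, eq_inv_of_mul_eq_one_left hdet]
  have h2 : ((2 * Real.pi : ℝ) ^ ((Module.finrank ℝ E : ℝ) / 2))
      = ((2 * Real.pi : ℝ) ^ ((2 : ℕ) : ℝ)⁻¹) ^ Module.finrank ℝ E := by
    rw [← Real.rpow_natCast, ← Real.rpow_mul (by positivity)]
    congr 1
    push_cast
    ring
  rw [h1, h2]
  push_cast
  rw [Complex.ofReal_cpow (by positivity)]
  simp [mul_comm]

end DetSquare

/-! ### Pluriharmonicity as annihilation by second order operators. -/

section Pluriharmonic

variable {E : Type*} [NormedAddCommGroup E] [InnerProductSpace ℝ E] [FiniteDimensional ℝ E]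
  {ι : Type*} [Fintype ι] (b : Module.Basis ι ℝ E)

/-- By the chain rule the Laplacian contracts the Hessian of p with R Rᵗ, which is R² because R is
symmetric. -/
theorem laplacian_polyEvalReal_comp {R : Module.End ℝ E} (hR : R.IsSymmetric)
    (p : MvPolynomial ι ℂ) (ξ : E) :
    Laplacian.laplacian (fun ζ : E => polyEvalReal b p (R ζ)) ξ
      = polyEvalReal b (quadOp (fun i j =>
          ((inner ℝ ((R * R) (dualVec b i)) (dualVec b j) : ℝ) : ℂ)) p) (R ξ) := by
  set L : E →L[ℝ] E := LinearMap.toContinuousLinearMap R with hL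
  have hLR : ∀ ζ, L ζ = R ζ := fun _ => rfl
  have hd : ∀ (q : MvPolynomial ι ℂ) (ζ : E), HasFDerivAt (fun ζ => polyEvalReal b q (R ζ))
      (∑ i, polyEvalReal b (MvPolynomial.pderiv i q) (R ζ) • (coordCLM b i ∘L L)) ζ := by
    intro q ζ
    refine ((hasFDerivAt_polyEvalReal b q (L ζ)).comp ζ L.hasFDerivAt).congr_fderiv ?_
    ext v
    simp [hLR, sum_apply]
  have hfd : fderiv ℝ (fun ζ => polyEvalReal b p (R ζ)) = fun ζ =>
      ∑ i, polyEvalReal b (MvPolynomial.pderiv i p) (R ζ) • (coordCLM b i ∘L L) :=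
    funext fun ζ => (hd p ζ).fderiv
  have h2 : HasFDerivAt (fun ζ =>
      ∑ i, polyEvalReal b (MvPolynomial.pderiv i p) (R ζ) • (coordCLM b i ∘L L))
      (∑ i, (∑ j, polyEvalReal b (MvPolynomial.pderiv j (MvPolynomial.pderiv i p)) (R ξ) •
        (coordCLM b j ∘L L)).smulRight (coordCLM b i ∘L L)) ξ :=
    HasFDerivAt.fun_sum fun i _ =>
      (hd (MvPolynomial.pderiv i p) ξ).smul_const (coordCLM b i ∘L L)
  rw [InnerProductSpace.laplacian_eq_iteratedFDeriv_orthonormalBasis _ (stdOrthonormalBasis ℝ E)]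
  simp only [iteratedFDeriv_two_apply, hfd, h2.fderiv]
  simp only [sum_apply, ContinuousLinearMap.smulRight_apply, smul_apply,
    ContinuousLinearMap.comp_apply, coordCLM_apply, hLR, smul_eq_mul, Matrix.cons_val_zero,
    Matrix.cons_val_one, Matrix.cons_val_fin_one]
  have hsum : ∀ i j, ∑ a, b.repr (R (stdOrthonormalBasis ℝ E a)) j
      * b.repr (R (stdOrthonormalBasis ℝ E a)) i
      = inner ℝ ((R * R) (dualVec b i)) (dualVec b j) := by
    intro i j
    rw [Module.End.mul_apply, hR, real_inner_comm,
      ← (stdOrthonormalBasis ℝ E).sum_inner_mul_inner]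
    refine Finset.sum_congr rfl fun a _ => ?_
    rw [← inner_dualVec, ← inner_dualVec, ← hR, ← hR, real_inner_comm (R (dualVec b i))]
  have hR' : polyEvalReal b (quadOp (fun i j =>
          ((inner ℝ ((R * R) (dualVec b i)) (dualVec b j) : ℝ) : ℂ)) p) (R ξ)
      = ∑ i, ∑ j, ((inner ℝ ((R * R) (dualVec b i)) (dualVec b j) : ℝ) : ℂ) *
        polyEvalReal b (MvPolynomial.pderiv j (MvPolynomial.pderiv i p)) (R ξ) := by
    simp only [polyEvalReal, quadOp, map_sum, MvPolynomial.smul_eval]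
  rw [hR', Finset.sum_comm]
  refine Finset.sum_congr rfl fun i _ => ?_
  simp only [Finset.sum_mul]
  rw [Finset.sum_comm]
  refine Finset.sum_congr rfl fun j _ => ?_
  rw [← hsum]
  push_cast
  rw [Finset.sum_mul]
  refine Finset.sum_congr rfl fun a _ => ?_
  ring

omit [FiniteDimensional ℝ E] in
theorem eq_zero_of_polyEvalReal_eq_zero {p : MvPolynomial ι ℂ}
    (h : ∀ ξ : E, polyEvalReal b p ξ = 0) : p = 0 := by
  refine MvPolynomial.funext_set (fun _ => Set.range ((↑) : ℝ → ℂ))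
    (fun _ => Set.infinite_range_of_injective Complex.ofReal_injective) fun u hu => ?_
  have hu' : ∀ i, ∃ r : ℝ, (r : ℂ) = u i := fun i => hu i (Set.mem_univ i)
  choose r hr using hu'
  have := h (b.equivFun.symm r)
  rw [polyEvalReal] at this
  rw [map_zero, ← this]
  congr 2
  ext i
  rw [← hr i]
  congr 1
  exact (congr_fun (b.equivFun.apply_symm_apply r) i).symm

variable {J : Type*} [NonAssocCommRing J] [Module ℝ J] {Φ : J →ₗ[ℝ] Module.End ℝ E}

theorem IsRepresentation.exists_add_smul_one_mem_cone (hΦ : IsRepresentation Φ)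
    (hinj : Function.Injective Φ) (x : J) : ∃ t : ℝ, x + t • 1 ∈ cone J := by
  refine ⟨‖LinearMap.toContinuousLinearMap (Φ x)‖ + 1, ?_⟩
  rw [hΦ.mem_cone_iff hinj]
  intro ξ hξ
  have h1 := (abs_le.1 (abs_real_inner_le_norm (Φ x ξ) ξ)).1
  have h2 := (LinearMap.toContinuousLinearMap (Φ x)).le_opNorm ξ
  rw [LinearMap.coe_toContinuousLinearMap'] at h2
  have h3 : 0 < ‖ξ‖ := norm_pos_iff.2 hξ
  rw [map_add, map_smul, hΦ.map_one, LinearMap.add_apply, LinearMap.smul_apply,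
    Module.End.one_apply, inner_add_left, real_inner_smul_left, real_inner_self_eq_norm_sq]
  nlinarith [mul_le_mul_of_nonneg_right h2 h3.le, mul_pos h3 h3]

/-- For y = x² the Laplacian of p ∘ Φ(x) is the operator of Φ(y) applied to p, taken at Φ(x)ξ. As
Φ(x) is onto, the resulting polynomial vanishes at all real points. -/
theorem IsPluriharmonic.quadOp_eq_zero_of_mem_cone (hΦ : IsRepresentation Φ)
    {p : MvPolynomial ι ℂ} (hp : IsPluriharmonic Φ b p) {y : J} (hy : y ∈ cone J) :
    quadOp (fun i j => ((inner ℝ (Φ y (dualVec b i)) (dualVec b j) : ℝ) : ℂ)) p = 0 := by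
  obtain ⟨x, w, hw, rfl⟩ := hy
  refine eq_zero_of_polyEvalReal_eq_zero b fun ξ => ?_
  have h1 := hp x (Φ w ξ)
  have h2 : Φ x (Φ w ξ) = ξ := LinearMap.congr_fun (hw.map_mul_eq_one hΦ.isJordanHom) ξ
  rwa [laplacian_polyEvalReal_comp b (hΦ.symm x), h2, ← hΦ.map_sq] at h1

/-- The operator is linear in x, and x is the difference of x + te and te, where x + te and e lie in
the cone. -/
theorem IsPluriharmonic.quadOp_eq_zero (hΦ : IsRepresentation Φ) (hinj : Function.Injective Φ)
    {p : MvPolynomial ι ℂ} (hp : IsPluriharmonic Φ b p) (x : J) :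
    quadOp (fun i j => ((inner ℝ (Φ x (dualVec b i)) (dualVec b j) : ℝ) : ℂ)) p = 0 := by
  obtain ⟨t, ht⟩ := hΦ.exists_add_smul_one_mem_cone hinj x
  have h1 := hp.quadOp_eq_zero_of_mem_cone b hΦ ht
  have h2 := hp.quadOp_eq_zero_of_mem_cone b hΦ (hΦ.one_mem_cone hinj)
  simp only [quadOp, map_add, map_smul, LinearMap.add_apply, LinearMap.smul_apply, inner_add_left,
    real_inner_smul_left, Complex.ofReal_add, Complex.ofReal_mul, add_smul, mul_smul,
    Finset.sum_add_distrib, ← Finset.smul_sum] at h1 h2 ⊢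
  rwa [h2, smul_zero, add_zero] at h1

theorem IsPluriharmonic.quadOp_invCoeff (hΦ : IsRepresentation Φ) (hinj : Function.Injective Φ)
    {p : MvPolynomial ι ℂ} (hp : IsPluriharmonic Φ b p) (x y : J) :
    quadOp (invCoeff b (Φ y) (Φ x)) p = 0 := by
  have h1 := hp.quadOp_eq_zero b hΦ hinj x
  have h2 := hp.quadOp_eq_zero b hΦ hinj y
  simp only [quadOp, invCoeff, sub_smul, mul_smul, Finset.sum_sub_distrib,
    ← Finset.smul_sum] at h1 h2 ⊢
  rw [h1, h2, smul_zero, sub_zero]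

end Pluriharmonic

/-! ### The branch of the power of the determinant -/

section Tube

variable {J : Type*} [NonAssocCommRing J] [Module ℝ J] [Module.Finite ℝ J]
  {E : Type*} [NormedAddCommGroup E] [InnerProductSpace ℝ E] [FiniteDimensional ℝ E]
  {Φ : J →ₗ[ℝ] Module.End ℝ E}

omit [Module.Finite ℝ J] in
theorem IsRepresentation.convex_tube (hΦ : IsRepresentation Φ) (hinj : Function.Injective Φ) :
    Convex ℝ (tube J) := by
  rintro _ ⟨x, y, hy, rfl⟩ _ ⟨x', y', hy', rfl⟩ a b ha hb hab
  refine ⟨a • x + b • x', a • y + b • y', hΦ.convex_cone hinj hy hy' ha hb hab, ?_⟩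
  simp only [TensorProduct.tmul_add, TensorProduct.tmul_smul, smul_add]
  abel

theorem IsRepresentation.isPreconnected_tube_coord (hΦ : IsRepresentation Φ)
    (hinj : Function.Injective Φ) :
    IsPreconnected
      {u | ((Module.finBasis ℝ J).baseChange ℂ).equivFun.symm u ∈ tube J} :=
  ((hΦ.convex_tube hinj).linear_preimage
    (((Module.finBasis ℝ J).baseChange ℂ).equivFun.symm.toLinearMap.restrictScalars
      ℝ)).isPreconnected

theorem continuous_cdet_coord :
    Continuous fun u : Fin (Module.finrank ℝ J) → ℂ =>
      cdet ((Complex.I)⁻¹ • ((Module.finBasis ℝ J).baseChange ℂ).equivFun.symm u) := by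
  have h : ∀ u : Fin (Module.finrank ℝ J) → ℂ,
      cdet ((Complex.I)⁻¹ • ((Module.finBasis ℝ J).baseChange ℂ).equivFun.symm u)
        = MvPolynomial.eval ((Complex.I)⁻¹ • u)
          (MvPolynomial.map (algebraMap ℝ ℂ) (detPoly J)) := by
    intro u
    rw [cdet, polyEval]
    congr 2
    ext i
    rw [← map_smul]
    exact congr_fun (((Module.finBasis ℝ J).baseChange ℂ).equivFun.apply_symm_apply _) i
  simp only [h]
  exact (MvPolynomial.continuous_eval _).comp (continuous_const_smul _)

theorem cdet_one_tmul (y : J) : cdet ((1 : ℂ) ⊗ₜ[ℝ] y) = jdet y := by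
  rw [cdet, polyEval_one_tmul, polyEvalReal, jdet, MvPolynomial.eval_map,
    ← Complex.coe_algebraMap, ← Function.comp_def (algebraMap ℝ ℂ), ← MvPolynomial.eval₂_comp]

omit [Module.Finite ℝ J] in
theorem inv_I_smul_tmul (y : J) :
    (Complex.I)⁻¹ • (Complex.I ⊗ₜ[ℝ] y : ℂ ⊗[ℝ] J) = (1 : ℂ) ⊗ₜ[ℝ] y := by
  rw [TensorProduct.smul_tmul', smul_eq_mul, inv_mul_cancel₀ Complex.I_ne_zero]

omit [Module.Finite ℝ J] in
theorem I_tmul_mem_tube {y : J} (hy : y ∈ cone J) : Complex.I ⊗ₜ[ℝ] y ∈ tube J :=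
  ⟨0, y, hy, by simp⟩

omit [Module.Finite ℝ J] [FiniteDimensional ℝ E] in
theorem complexRep_inv_I_smul (x y : J) :
    complexRep Φ ((Complex.I)⁻¹ • ((1 : ℂ) ⊗ₜ[ℝ] x + Complex.I ⊗ₜ[ℝ] y))
      = LinearMap.baseChange ℂ (Φ y) - Complex.I • LinearMap.baseChange ℂ (Φ x) := by
  rw [map_smul, map_add, complexRep_tmul, complexRep_tmul, smul_add, one_smul, smul_smul,
    inv_mul_cancel₀ Complex.I_ne_zero, one_smul, Complex.inv_I, neg_smul]
  abel

theorem IsRepresentation.cdet_ne_zero [IsSimpleRing J] [Nontrivial E]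
    (hΦ : IsRepresentation Φ) (hinj : Function.Injective Φ) {z : ℂ ⊗[ℝ] J} (hz : z ∈ tube J) :
    cdet ((Complex.I)⁻¹ • z) ≠ 0 := by
  obtain ⟨k, hk0, hk⟩ := hΦ.exists_multiplicity hinj
  intro h
  have h1 := hΦ.cdet_pow hinj hk ((Complex.I)⁻¹ • z)
  rw [h, zero_pow hk0.ne', map_smul, LinearMap.det_smul] at h1
  exact mul_ne_zero (pow_ne_zero _ (inv_ne_zero Complex.I_ne_zero))
    (hΦ.det_complexRep_ne_zero hz) h1.symm

omit [FiniteDimensional ℝ E] in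
theorem baseChange_qmap {B : LinearMap.BilinForm ℝ J} (hB : IsEuclideanForm B) (x y : J) (ξ : E) :
    LinearMap.BilinForm.baseChange ℂ B ((1 : ℂ) ⊗ₜ[ℝ] x + Complex.I ⊗ₜ[ℝ] y)
        ((1 : ℂ) ⊗ₜ[ℝ] qmap hB Φ ξ)
      = ((inner ℝ (Φ x ξ) ξ : ℝ) : ℂ) + Complex.I * ((inner ℝ (Φ y ξ) ξ : ℝ) : ℂ) := by
  rw [map_add, LinearMap.add_apply, LinearMap.BilinForm.baseChange_tmul,
    LinearMap.BilinForm.baseChange_tmul, hB.symm, hB.symm y, qmap, hmap_spec, hmap_spec]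
  simp [mul_comm]

omit [FiniteDimensional ℝ E] in
theorem baseChange_coord_qmap {B : LinearMap.BilinForm ℝ J} (hB : IsEuclideanForm B)
    (u : Fin (Module.finrank ℝ J) → ℂ) (ξ : E) :
    LinearMap.BilinForm.baseChange ℂ B
        (((Module.finBasis ℝ J).baseChange ℂ).equivFun.symm u) ((1 : ℂ) ⊗ₜ[ℝ] qmap hB Φ ξ)
      = ∑ i, u i * ((inner ℝ (Φ (Module.finBasis ℝ J i) ξ) ξ : ℝ) : ℂ) := by
  rw [Module.Basis.equivFun_symm_apply, map_sum, LinearMap.sum_apply]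
  refine Finset.sum_congr rfl fun i _ => ?_
  rw [map_smul, LinearMap.smul_apply, Module.Basis.baseChange_apply,
    LinearMap.BilinForm.baseChange_tmul, hB.symm, qmap, hmap_spec]
  simp

variable [MeasurableSpace E] [BorelSpace E] {B : LinearMap.BilinForm ℝ J}

/-- The normalized integral of the Gaussian `exp (i/2 (z, Q(ξ)))`. -/
def gaussBranch (hB : IsEuclideanForm B) (Φ : J →ₗ[ℝ] Module.End ℝ E) (z : ℂ ⊗[ℝ] J) : ℂ :=
  (((2 * Real.pi) ^ ((Module.finrank ℝ E : ℝ) / 2) : ℝ) : ℂ)⁻¹ *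
    ∫ ξ : E, Complex.exp (Complex.I / 2 *
      LinearMap.BilinForm.baseChange ℂ B z ((1 : ℂ) ⊗ₜ[ℝ] qmap hB Φ ξ))

variable (hB : IsEuclideanForm B)

theorem gaussBranch_eq (x y : J) :
    gaussBranch hB Φ ((1 : ℂ) ⊗ₜ[ℝ] x + Complex.I ⊗ₜ[ℝ] y)
      = (((2 * Real.pi) ^ ((Module.finrank ℝ E : ℝ) / 2) : ℝ) : ℂ)⁻¹ *
        ∫ ξ, gaussExp (Φ y) (Φ x) 0 ξ := by
  simp only [gaussBranch, baseChange_qmap, gaussExp, inner_zero_right, Complex.ofReal_zero,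
    mul_zero, Complex.exp_zero, one_mul]

theorem gaussBranch_sq_mul [IsSimpleRing J] [Nontrivial E] (hΦ : IsRepresentation Φ)
    (hinj : Function.Injective Φ) {k : ℕ} (hk : k * jrank J = Module.finrank ℝ E)
    {z : ℂ ⊗[ℝ] J} (hz : z ∈ tube J) :
    gaussBranch hB Φ z ^ 2 * cdet ((Complex.I)⁻¹ • z) ^ k = 1 := by
  rw [hΦ.cdet_pow hinj hk]
  obtain ⟨x, y, hy, rfl⟩ := hz
  obtain ⟨W, V, hW, hWV, hVW, hs⟩ := hΦ.exists_sqrt_of_mem_cone hy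
  have hpi : (0 : ℝ) < 2 * Real.pi := by positivity
  have hc : (((2 * Real.pi) ^ ((Module.finrank ℝ E : ℝ) / 2) : ℝ) : ℂ) ^ 2
      = (2 * Real.pi) ^ Module.finrank ℝ E := by
    rw [← Complex.ofReal_pow, ← Real.rpow_natCast, ← Real.rpow_mul hpi.le,
      Nat.cast_ofNat, div_mul_cancel₀ _ (two_ne_zero), Real.rpow_natCast]
    push_cast
    rfl
  rw [gaussBranch_eq, complexRep_inv_I_smul, hW, mul_pow, mul_assoc,
    sq_integral_gaussExp_mul_det (hΦ.symm x) hs hWV hVW, inv_pow, hc]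
  refine inv_mul_cancel₀ (pow_ne_zero _ ?_)
  exact_mod_cast hpi.ne'

theorem gaussBranch_I_tmul [IsSimpleRing J] [Nontrivial E] (hΦ : IsRepresentation Φ)
    (hinj : Function.Injective Φ) {y : J} (hy : y ∈ cone J) :
    gaussBranch hB Φ (Complex.I ⊗ₜ[ℝ] y)
      = ((jdet y ^ (-((Module.finrank ℝ E : ℝ) / (2 * (jrank J : ℝ)))) : ℝ) : ℂ) := by
  obtain ⟨k, hk0, hk⟩ := hΦ.exists_multiplicity hinj
  obtain ⟨W, V, hW, hWV, hVW, hs⟩ := hΦ.exists_sqrt_of_mem_cone hy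
  have h := gaussBranch_eq (Φ := Φ) hB 0 y
  have hr : (jrank J : ℝ) ≠ 0 := by exact_mod_cast (hΦ.jrank_pos hinj).ne'
  have hpi : (0 : ℝ) < (2 * Real.pi) ^ ((Module.finrank ℝ E : ℝ) / 2) := by positivity
  rw [TensorProduct.tmul_zero, zero_add, map_zero, hW, integral_gaussExp_zero_zero hs hWV hVW,
    Complex.ofReal_mul, inv_mul_cancel_left₀ (by exact_mod_cast hpi.ne'), ← hW,
    ← hΦ.jdet_pow hinj hk, ← Real.rpow_natCast, ← Real.rpow_mul (hΦ.jdet_pos hinj hy).le] at h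
  rw [h]
  congr 2
  rw [← hk]
  push_cast
  field_simp

theorem continuousOn_gaussBranch (hΦ : IsRepresentation Φ) :
    ContinuousOn
      (fun u : Fin (Module.finrank ℝ J) → ℂ =>
        gaussBranch hB Φ (((Module.finBasis ℝ J).baseChange ℂ).equivFun.symm u))
      {u | ((Module.finBasis ℝ J).baseChange ℂ).equivFun.symm u ∈ tube J} := by
  rintro v ⟨x, y, hy, hv⟩
  obtain ⟨W, V, hW, hWV, hVW, hs⟩ := hΦ.exists_sqrt_of_mem_cone hy
  obtain ⟨c, hc, hcW⟩ := exists_le_inner_mul_self hs hVW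
  rw [← hW] at hcW
  set K : Fin (Module.finrank ℝ J) → ℝ := fun i =>
    ‖LinearMap.toContinuousLinearMap (Φ (Module.finBasis ℝ J i))‖ with hK
  have hKi : ∀ i (ξ : E), |inner ℝ (Φ (Module.finBasis ℝ J i) ξ) ξ| ≤ K i * ‖ξ‖ ^ 2 := by
    intro i ξ
    have h1 := (LinearMap.toContinuousLinearMap (Φ (Module.finBasis ℝ J i))).le_opNorm ξ
    calc _ ≤ ‖Φ (Module.finBasis ℝ J i) ξ‖ * ‖ξ‖ := abs_real_inner_le_norm _ _
      _ ≤ K i * ‖ξ‖ * ‖ξ‖ := mul_le_mul_of_nonneg_right h1 (norm_nonneg _)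
      _ = _ := by ring
  have him : ∀ ξ : E, c * ‖ξ‖ ^ 2 ≤
      (∑ i, v i * ((inner ℝ (Φ (Module.finBasis ℝ J i) ξ) ξ : ℝ) : ℂ)).im := by
    intro ξ
    rw [← baseChange_coord_qmap hB v ξ, hv, baseChange_qmap]
    simpa using hcW ξ
  -- Near v the imaginary part of the form stays above (c/2)‖ξ‖², so exp(-(c/4)‖ξ‖²) dominates the
  -- integrands.
  have hnear : ∀ᶠ u in nhds v, ∑ i, ‖u i - v i‖ * K i < c / 2 := by
    have hcont : Continuous fun u : Fin (Module.finrank ℝ J) → ℂ => ∑ i, ‖u i - v i‖ * K i := by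
      fun_prop
    exact hcont.continuousAt.eventually_lt continuousAt_const (by simpa using hc)
  have hcontE : ∀ i, Continuous fun ξ : E =>
      ((inner ℝ (Φ (Module.finBasis ℝ J i) ξ) ξ : ℝ) : ℂ) := by
    intro i
    have := LinearMap.continuous_of_finiteDimensional (Φ (Module.finBasis ℝ J i))
    fun_prop
  simp only [gaussBranch, baseChange_coord_qmap]
  refine (ContinuousAt.mul continuousAt_const (continuousAt_of_dominated
    (bound := fun ξ => Real.exp (-(c / 4) * ‖ξ‖ ^ 2)) ?_ ?_
    (integrable_exp_neg_mul_sq_norm (by positivity)) ?_)).continuousWithinAt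
  · refine Filter.Eventually.of_forall fun u => Continuous.aestronglyMeasurable ?_
    fun_prop
  · filter_upwards [hnear] with u hu
    refine Filter.Eventually.of_forall fun ξ => ?_
    rw [Complex.norm_exp]
    refine Real.exp_le_exp.2 ?_
    have h1 : (Complex.I / 2 *
        ∑ i, u i * ((inner ℝ (Φ (Module.finBasis ℝ J i) ξ) ξ : ℝ) : ℂ)).re
        = -(1 / 2) * (∑ i, u i * ((inner ℝ (Φ (Module.finBasis ℝ J i) ξ) ξ : ℝ) : ℂ)).im := by
      rw [div_mul_eq_mul_div, mul_div_assoc, Complex.I_mul_re, Complex.div_ofNat_im]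
      ring
    have h2 : (∑ i, v i * ((inner ℝ (Φ (Module.finBasis ℝ J i) ξ) ξ : ℝ) : ℂ)).im
        - (∑ i, u i * ((inner ℝ (Φ (Module.finBasis ℝ J i) ξ) ξ : ℝ) : ℂ)).im
        ≤ (∑ i, ‖u i - v i‖ * K i) * ‖ξ‖ ^ 2 := by
      rw [Complex.im_sum, Complex.im_sum, ← Finset.sum_sub_distrib, Finset.sum_mul]
      refine Finset.sum_le_sum fun i _ => ?_
      rw [Complex.im_mul_ofReal, Complex.im_mul_ofReal, ← sub_mul, ← Complex.sub_im, mul_assoc]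
      refine (le_abs_self _).trans ?_
      rw [abs_mul]
      refine mul_le_mul ?_ (hKi i ξ) (abs_nonneg _) (norm_nonneg _)
      rw [norm_sub_rev]
      exact Complex.abs_im_le_norm _
    rw [h1]
    nlinarith [him ξ, sq_nonneg ‖ξ‖, mul_le_mul_of_nonneg_right hu.le (sq_nonneg ‖ξ‖)]
  · refine Filter.Eventually.of_forall fun ξ => Continuous.continuousAt ?_
    fun_prop

omit [MeasurableSpace E] [BorelSpace E] in
-- On a connected set two continuous functions with equal nonzero squares differ by a constant sign,
-- which is read off at ie.
theorem eqOn_tube_of_sq_eq (hΦ : IsRepresentation Φ) (hinj : Function.Injective Φ)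
    {D D' : ℂ ⊗[ℝ] J → ℂ}
    (hD : ContinuousOn (fun u : Fin (Module.finrank ℝ J) → ℂ =>
        D (((Module.finBasis ℝ J).baseChange ℂ).equivFun.symm u))
      {u | ((Module.finBasis ℝ J).baseChange ℂ).equivFun.symm u ∈ tube J})
    (hD' : ContinuousOn (fun u : Fin (Module.finrank ℝ J) → ℂ =>
        D' (((Module.finBasis ℝ J).baseChange ℂ).equivFun.symm u))
      {u | ((Module.finBasis ℝ J).baseChange ℂ).equivFun.symm u ∈ tube J})
    (hsq : ∀ z ∈ tube J, D z ^ 2 = D' z ^ 2) (hne : ∀ z ∈ tube J, D' z ≠ 0)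
    (h1 : D (Complex.I ⊗ₜ[ℝ] (1 : J)) = D' (Complex.I ⊗ₜ[ℝ] (1 : J))) :
    Set.EqOn D D' (tube J) := by
  intro z hz
  have he := ((Module.finBasis ℝ J).baseChange ℂ).equivFun.symm_apply_apply
  have := (hΦ.isPreconnected_tube_coord hinj).eq_of_sq_eq hD hD'
    (fun u hu => hsq _ hu) (fun {u} hu => hne _ hu)
    (y := ((Module.finBasis ℝ J).baseChange ℂ).equivFun (Complex.I ⊗ₜ[ℝ] (1 : J)))
    (by
      rw [Set.mem_ofPred_eq, he]
      exact I_tmul_mem_tube (hΦ.one_mem_cone hinj))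
    (by rw [he, h1])
    (x := ((Module.finBasis ℝ J).baseChange ℂ).equivFun z)
    (by rwa [Set.mem_ofPred_eq, he])
  simpa only [he] using this

variable [IsSimpleRing J] [Nontrivial E]

omit [MeasurableSpace E] [BorelSpace E] [IsSimpleRing J] in
theorem IsRepresentation.neg_finrank_div_eq (hΦ : IsRepresentation Φ)
    (hinj : Function.Injective Φ) {k : ℕ} (hk : k * jrank J = Module.finrank ℝ E) :
    -((Module.finrank ℝ E : ℝ) / (2 * (jrank J : ℝ))) = -((k : ℝ) / 2) := by
  have hr : (jrank J : ℝ) ≠ 0 := by exact_mod_cast (hΦ.jrank_pos hinj).ne'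
  rw [← hk]
  push_cast
  field_simp

theorem isDetPowBranch_gaussBranch (hΦ : IsRepresentation Φ) (hinj : Function.Injective Φ) :
    IsDetPowBranch J (-((Module.finrank ℝ E : ℝ) / (2 * (jrank J : ℝ)))) (gaussBranch hB Φ) where
  continuousOn := continuousOn_gaussBranch hB hΦ
  normalized _ hy := gaussBranch_I_tmul hB hΦ hinj hy
  isPower z hz := by
    obtain ⟨k, hk0, hk⟩ := hΦ.exists_multiplicity hinj
    have hsq := fun w (hw : w ∈ tube J) => gaussBranch_sq_mul hB hΦ hinj hk hw
    have hdet := fun w (hw : w ∈ tube J) => hΦ.cdet_ne_zero hinj hw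
    rw [hΦ.neg_finrank_div_eq hinj hk]
    set c := cdet ((Complex.I)⁻¹ • z) with hc
    have hlog : Complex.exp (Complex.log c) = c := Complex.exp_log (hdet z hz)
    obtain ⟨m, rfl | rfl⟩ := Nat.even_or_odd' k
    -- For k = 2m the power is the single-valued (det)^(-m), and no choice of logarithm can repair a
    -- sign; equality comes from connectedness of the tube.
    · refine ⟨Complex.log c, hlog, ?_⟩
      have heq := eqOn_tube_of_sq_eq hΦ hinj (continuousOn_gaussBranch hB hΦ)
        (D' := fun w => (cdet ((Complex.I)⁻¹ • w) ^ m)⁻¹)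
        (ContinuousOn.inv₀ (continuous_cdet_coord.pow m).continuousOn
          fun u hu => pow_ne_zero _ (hdet _ hu))
        (fun w hw => by
          rw [inv_pow, ← pow_mul, mul_comm m 2]
          exact eq_inv_of_mul_eq_one_left (hsq w hw))
        (fun w hw => inv_ne_zero (pow_ne_zero _ (hdet w hw)))
        (by
          have hj := hΦ.jdet_pos hinj (hΦ.one_mem_cone hinj)
          rw [gaussBranch_I_tmul hB hΦ hinj (hΦ.one_mem_cone hinj), inv_I_smul_tmul,
            cdet_one_tmul, hΦ.neg_finrank_div_eq hinj hk, Nat.cast_mul, Nat.cast_ofNat,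
            mul_div_cancel_left₀ _ two_ne_zero, Real.rpow_neg hj.le, Real.rpow_natCast]
          push_cast
          rfl) hz
      rw [heq]
      beta_reduce
      rw [← hc, ← hlog, ← Complex.exp_nat_mul, ← Complex.exp_neg, hlog]
      congr 1
      push_cast
      ring
    · have h2 : gaussBranch hB Φ z ^ 2
          = Complex.exp (((-(((2 * m + 1 : ℕ) : ℝ) / 2) : ℝ) : ℂ) * Complex.log c) ^ 2 := by
        rw [eq_inv_of_mul_eq_one_left (hsq z hz), ← hc, ← Complex.exp_nat_mul, ← hlog,
          ← Complex.exp_nat_mul, ← Complex.exp_neg, hlog]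
        congr 1
        push_cast
        ring
      rcases sq_eq_sq_iff_eq_or_eq_neg.1 h2 with h | h
      · exact ⟨Complex.log c, hlog, h⟩
      -- For k odd the exponent is a half-integer, so shifting the logarithm by 2πi changes the
      -- sign.
      · refine ⟨Complex.log c + 2 * Real.pi * Complex.I, ?_, ?_⟩
        · rw [Complex.exp_add, Complex.exp_two_pi_mul_I, mul_one, hlog]
        · have h3 : ((-(((2 * m + 1 : ℕ) : ℝ) / 2) : ℝ) : ℂ) * (2 * Real.pi * Complex.I)
              = -(m * (2 * Real.pi * Complex.I) + Real.pi * Complex.I) := by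
            push_cast
            ring
          rw [h, mul_add, Complex.exp_add, h3, Complex.exp_neg, Complex.exp_add,
            Complex.exp_nat_mul_two_pi_mul_I, Complex.exp_pi_mul_I]
          simp

/-- Both functions have square det(z/i)^(-k), are continuous on the tube and agree at ie. -/
theorem IsDetPowBranch.eqOn_gaussBranch (hΦ : IsRepresentation Φ) (hinj : Function.Injective Φ)
    {D : ℂ ⊗[ℝ] J → ℂ}
    (hD : IsDetPowBranch J (-((Module.finrank ℝ E : ℝ) / (2 * (jrank J : ℝ)))) D) :
    Set.EqOn D (gaussBranch hB Φ) (tube J) := by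
  obtain ⟨k, hk0, hk⟩ := hΦ.exists_multiplicity hinj
  have hsq := fun w (hw : w ∈ tube J) => gaussBranch_sq_mul hB hΦ hinj hk hw
  refine eqOn_tube_of_sq_eq hΦ hinj hD.continuousOn (continuousOn_gaussBranch hB hΦ) ?_ ?_ ?_
  · intro z hz
    obtain ⟨l, hl, h⟩ := hD.isPower z hz
    rw [eq_inv_of_mul_eq_one_left (hsq z hz), h, hΦ.neg_finrank_div_eq hinj hk, ← hl,
      ← Complex.exp_nat_mul, ← Complex.exp_nat_mul, ← Complex.exp_neg]
    congr 1
    push_cast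
    ring
  · intro z hz h0
    have := hsq z hz
    rw [h0] at this
    simp at this
  · rw [hD.normalized 1 (hΦ.one_mem_cone hinj),
      gaussBranch_I_tmul hB hΦ hinj (hΦ.one_mem_cone hinj)]

end Tube

end JordanHecke

end
-- The transformation formula.
theorem proposition3 {J : Type*} [NonAssocCommRing J] [Module ℝ J] [SMulCommClass ℝ J J]
    [IsScalarTower ℝ J J] [IsCommJordan J] [Module.Finite ℝ J] [IsSimpleRing J]
    (B : LinearMap.BilinForm ℝ J) (hB : JordanHecke.IsEuclideanForm B)
    {E : Type*} [NormedAddCommGroup E] [InnerProductSpace ℝ E] [FiniteDimensional ℝ E]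
    [MeasurableSpace E] [BorelSpace E]
    (Φ : J →ₗ[ℝ] Module.End ℝ E) (hΦ : JordanHecke.IsRepresentation Φ)
    (hreg : JordanHecke.IsRegularRep hB Φ)
    {ι : Type*} (b : Module.Basis ι ℝ E) (p : MvPolynomial ι ℂ)
    (hp : JordanHecke.IsPluriharmonic Φ b p) :
    (∃ D : ℂ ⊗[ℝ] J → ℂ, JordanHecke.IsDetPowBranch J
        (-((Module.finrank ℝ E : ℝ) / (2 * (JordanHecke.jrank J : ℝ)))) D) ∧
    ∀ D : ℂ ⊗[ℝ] J → ℂ, JordanHecke.IsDetPowBranch J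
        (-((Module.finrank ℝ E : ℝ) / (2 * (JordanHecke.jrank J : ℝ)))) D →
      ∀ z ∈ JordanHecke.tube J,
        JordanHecke.IsJInverse ℂ z (JordanHecke.jinv ℂ z) ∧
        ∀ η : E,
          Integrable (fun ξ : E =>
            Complex.exp (Complex.I * ((inner ℝ ξ η : ℝ) : ℂ)) *
            Complex.exp (Complex.I / 2 *
              LinearMap.BilinForm.baseChange ℂ B z
                ((1 : ℂ) ⊗ₜ[ℝ] JordanHecke.qmap hB Φ ξ)) *
            JordanHecke.polyEvalReal b p ξ) volume ∧
          ∫ ξ : E,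
            Complex.exp (Complex.I * ((inner ℝ ξ η : ℝ) : ℂ)) *
            Complex.exp (Complex.I / 2 *
              LinearMap.BilinForm.baseChange ℂ B z
                ((1 : ℂ) ⊗ₜ[ℝ] JordanHecke.qmap hB Φ ξ)) *
            JordanHecke.polyEvalReal b p ξ ∂volume =
          (((2 * Real.pi) ^ ((Module.finrank ℝ E : ℝ) / 2) : ℝ) : ℂ) * D z *
            Complex.exp (Complex.I / 2 *
              LinearMap.BilinForm.baseChange ℂ B (-JordanHecke.jinv ℂ z)
                ((1 : ℂ) ⊗ₜ[ℝ] JordanHecke.qmap hB Φ η)) *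
            JordanHecke.polyEval b p
              (JordanHecke.complexRep Φ (-JordanHecke.jinv ℂ z) ((1 : ℂ) ⊗ₜ[ℝ] η)) := by
  have hinj := hreg.injective hΦ
  have := hreg.nontrivial
  have : Fintype ι := FiniteDimensional.fintypeBasisIndex b
  refine ⟨⟨_, JordanHecke.isDetPowBranch_gaussBranch hB hΦ hinj⟩, fun D hD z hz =>
    ⟨hΦ.isJInverse_of_mem_tube hinj hz, fun η => ?_⟩⟩
  -- Since D is the normalized Gaussian integral at η = 0, it remains only to compare the integral
  -- with that one.
  rw [hD.eqOn_gaussBranch hB hΦ hinj hz]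
  obtain ⟨x, y, hy, rfl⟩ := hz
  obtain ⟨x', y', hinv, h1, h2⟩ := hΦ.exists_neg_jinv hinj (x := x) hy
  obtain ⟨W, V, hW, hWV, hVW, hs⟩ := hΦ.exists_sqrt_of_mem_cone hy
  obtain ⟨c, hc, hcW⟩ := JordanHecke.exists_le_inner_mul_self hs hVW
  have hpi : (0 : ℝ) < (2 * Real.pi) ^ ((Module.finrank ℝ E : ℝ) / 2) := by positivity
  have hint : (fun ξ : E => Complex.exp (Complex.I * ((inner ℝ ξ η : ℝ) : ℂ)) *
      Complex.exp (Complex.I / 2 * LinearMap.BilinForm.baseChange ℂ B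
        ((1 : ℂ) ⊗ₜ[ℝ] x + Complex.I ⊗ₜ[ℝ] y) ((1 : ℂ) ⊗ₜ[ℝ] JordanHecke.qmap hB Φ ξ)) *
      JordanHecke.polyEvalReal b p ξ) = fun ξ => JordanHecke.polyEvalReal b p ξ * JordanHecke.gaussExp (W * W) (Φ x) η ξ := by
    funext ξ
    rw [JordanHecke.baseChange_qmap, ← hW, mul_comm, JordanHecke.gaussExp]
  rw [hint, hinv, JordanHecke.gaussBranch_eq, JordanHecke.baseChange_qmap, JordanHecke.complexRep_apply]
  refine ⟨JordanHecke.integrable_polyEvalReal_mul_gaussExp b hc hcW η p, ?_⟩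
  -- The operator attached to the inverse quadratic form is the one of -z⁻¹, so it kills p.
  have hq := hp.quadOp_invCoeff b hΦ hinj x' y'
  rw [hW] at h1 h2 ⊢
  rw [JordanHecke.integral_polyEvalReal_mul_gaussExp b hc hcW (hW ▸ hΦ.symm y) (hΦ.symm x) (hΦ.symm y')
    (hΦ.symm x') h1 h2 η hq, JordanHecke.integral_gaussExp_eq_mul_exp (hΦ.symm x) hs hWV hVW h1 h2 η,
    mul_inv_cancel_left₀ (by exact_mod_cast hpi.ne')]
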